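/- Let $(\Omega,\mathcal F,\mathbb F=\{\mathcal F_t\}_{t\in[0,1]},P)$ be a filtered probability space and $X=\{X(t)\}_{t\in[0,1]}$ a real $\mathbb F$-adapted process. Let $\alpha>\tfrac12$ and assume: (i) almost surely there is a finite $C=C(\omega)$ such that $|X(t)-X(s)|\le C|t-s|^{\alpha}$ for all $s,t\in[0,1]$; (ii) there are constants $C>0$ and $\delta\in(0,1]$ such that for all $s<t$ in $[1-\delta,1]$, with $\Delta=t-s$, and all $0<\epsilon\le\Delta^{\alpha}$, $$P\Big(\sup_{s\le u\le t}|X(u)-X(s)|\le\epsilon\Big)\le\exp\big(-C\,\Delta\,\epsilon^{-1/\alpha}\big).$$ For $\beta\in(0,1)$ and $f,g\colon[a,b]\to\mathbb R$ put $g_{b-}(x)=g(x)-g(b)$, $$D_{a+}^{\beta}f(x)=\frac{1}{\Gamma(1-\beta)}\Big(\frac{f(x)}{(x-a)^{\beta}}+\beta\int_a^x\frac{f(x)-f(u)}{(x-u)^{\beta+1}}\,du\Big),$$ $$D_{b-}^{1-\beta}g(x)=\frac{e^{i\pi(1-\beta)}}{\Gamma(\beta)}\Big(\frac{g(x)}{(b-x)^{1-\beta}}+(1-\beta)\int_x^b\frac{g(x)-g(u)}{(u-x)^{2-\beta}}\,du\Big),$$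 $$\|f\|_{\beta;[a,b]}=\int_a^b\Big(\frac{|f(t)|}{(t-a)^{\beta}}+\int_a^t\frac{|f(t)-f(s)|}{(t-s)^{\beta+1}}\,ds\Big)dt.$$ The generalized Lebesgue--Stieltjes integral (with index $\beta$) $$\int_a^b f\,dg=e^{i\pi\beta}\int_a^b D_{a+}^{\beta}f(x)\,D_{b-}^{1-\beta}g_{b-}(x)\,dx$$ is said to exist if $\|f\|_{\beta;[a,b]}<\infty$, the inner integrals converge for almost every $x\in[a,b]$, $D_{a+}^{\beta}f\in L_1[a,b]$ and $D_{b-}^{1-\beta}g_{b-}\in L_\infty[a,b]$. Then there is an $\mathbb F$-adapted process $\phi=\{\phi(t)\}_{t\in[0,1)}$ with continuous paths and $\phi(0)=0$ such that, almost surely, for every $\beta\in(0,1)$ with $\beta>1-\alpha$, the integral $\int_0^t\phi(s)\,dX(s)$ exists with index $\beta$ for every $t\in[0,1)$ and $$\lim_{t\to1-}\int_0^t\phi(s)\,dX(s)=+\infty .$$ -/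

import Mathlib

open MeasureTheory Filter Topology

noncomputable section

/-- Left-sided (Weyl–Marchaud) fractional derivative `D_{a+}^β f` of order `β ∈ (0,1)`. -/
def leftFracDeriv (a β : ℝ) (f : ℝ → ℝ) (x : ℝ) : ℝ :=
  (1 / Real.Gamma (1 - β)) *
    (f x / (x - a) ^ β + β * ∫ u in a..x, (f x - f u) / (x - u) ^ (β + 1))

/-- Right-sided (Weyl–Marchaud) fractional derivative `D_{b-}^β g` of order `β ∈ (0,1)`, without
the conventional unimodular constant `(-1)^β = e^{iπβ}`; that constant is accounted for in
`glsIntegral`. -/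
def rightFracDeriv (b β : ℝ) (g : ℝ → ℝ) (x : ℝ) : ℝ :=
  (1 / Real.Gamma (1 - β)) *
    (g x / (b - x) ^ β + β * ∫ u in x..b, (g x - g u) / (u - x) ^ (β + 1))

/-- The norm `‖f‖_{β;[a,b]}`, with values in `[0,∞]`. -/
def glsNorm (β : ℝ) (f : ℝ → ℝ) (a b : ℝ) : ENNReal :=
  ∫⁻ t in Set.Ioc a b,
    (ENNReal.ofReal (|f t| / (t - a) ^ β) +
      ∫⁻ s in Set.Ioc a t, ENNReal.ofReal (|f t - f s| / (t - s) ^ (β + 1)))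

/-- The generalized Lebesgue–Stieltjes integral `∫_a^b f dg` exists with index `β`:
`f` is an admissible integrand (`‖f‖_{β;[a,b]} < ∞`), the fractional derivatives
`D_{a+}^β f` and `D_{b-}^{1-β} g_{b-}`, where `g_{b-} = g - g(b)`, are given by convergent integrals
almost everywhere on `[a,b]`, and they belong to `L_1[a,b]` and `L_∞[a,b]` respectively. -/
structure GLSIntegrable (β : ℝ) (f g : ℝ → ℝ) (a b : ℝ) : Prop where
  norm_lt_top : glsNorm β f a b < ⊤
  left_inner : ∀ᵐ x ∂(volume.restrict (Set.Ioc a b)),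
    IntervalIntegrable (fun u => (f x - f u) / (x - u) ^ (β + 1)) volume a x
  left_memLp : MemLp (leftFracDeriv a β f) 1 (volume.restrict (Set.Ioc a b))
  right_inner : ∀ᵐ x ∂(volume.restrict (Set.Ioc a b)),
    IntervalIntegrable (fun u => (g x - g u) / (u - x) ^ (1 - β + 1)) volume x b
  right_memLp : MemLp (rightFracDeriv b (1 - β) (fun x => g x - g b)) ⊤
    (volume.restrict (Set.Ioc a b))

/-- The generalized Lebesgue–Stieltjes integral
`∫_a^b f dg = (-1)^β ∫_a^b (D_{a+}^β f)(x) (D_{b-}^{1-β} g_{b-})(x) dx`.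
The minus sign is the product `(-1)^β (-1)^{1-β} = e^{iπβ} e^{iπ(1-β)} = -1` of the unimodular
constants; with it `∫_a^b 1 dg = g(b) - g(a)`. -/
def glsIntegral (β : ℝ) (f g : ℝ → ℝ) (a b : ℝ) : ℝ :=
  -∫ x in a..b, leftFracDeriv a β f x * rightFracDeriv b (1 - β) (fun y => g y - g b) x

/-- Almost every path of `X` is `α`-Hölder on `[0,1]`; the constant may depend on the path. -/
def HasHolderPaths {Ω : Type*} [MeasurableSpace Ω] (P : Measure Ω) (X : ℝ → Ω → ℝ) (α : ℝ) :
    Prop :=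
  ∀ᵐ ω ∂P, ∃ C : ℝ, ∀ s ∈ Set.Icc (0 : ℝ) 1, ∀ t ∈ Set.Icc (0 : ℝ) 1,
    |X t ω - X s ω| ≤ C * |t - s| ^ α

/-- Small ball estimate near the end point `1`: for `s < t` in `[1-δ,1]`, `Δ = t - s` and
`0 < ε ≤ Δ^α`, the event `sup_{s ≤ u ≤ t} |X(u) - X(s)| ≤ ε` has probability at most
`exp (-C Δ ε^{-1/α})`. -/
def HasSmallBallEstimate {Ω : Type*} [MeasurableSpace Ω] (P : Measure Ω) (X : ℝ → Ω → ℝ)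
    (α : ℝ) : Prop :=
  ∃ C : ℝ, 0 < C ∧ ∃ δ : ℝ, 0 < δ ∧ δ ≤ 1 ∧
    ∀ s ∈ Set.Icc (1 - δ) 1, ∀ t ∈ Set.Icc (1 - δ) 1, s < t →
      ∀ ε : ℝ, 0 < ε → ε ≤ (t - s) ^ α →
        P {ω | ∀ u ∈ Set.Icc s t, |X u ω - X s ω| ≤ ε} ≤
          ENNReal.ofReal (Real.exp (-(C * (t - s) * ε ^ (-(1 / α)))))

end

/-!
For a continuously differentiable integrand vanishing at the left end point, Fubini's theorem and
the inversion `I_{b-}^{1-β} D_{b-}^{1-β} g_{b-} = g - g(b)` turn the generalized Lebesgue–Stieltjes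
integral `∫_a^b f dg` into `∫_a^b f'(u) (g(b) - g(u)) du`, for every admissible `β`. It is
therefore, up to an error which is arbitrarily small for fast switching, a Riemann sum
`∑ c k (g(s (k + 1)) - g(s k))` when `f` is a step function with smoothed jumps.

On consecutive intervals `[τ n, τ (n + 1)]` accumulating at `1`, hold the position
`(2 / ε²) (X - X(τ n))` along a fine grid until `|X - X(τ n)|` reaches the level `ε = ε n`. Since
`2 x Δx = Δ(x²) - (Δx)²`, an interval on which the level is reached yields at least `1` and every
other one at least `0`, up to the quadratic variation along the grid; this error vanishes with the
mesh because `α > 1/2`. Choosing grids and switching times so that the errors are summable, the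
integral diverges on every path that reaches infinitely many levels. By the small ball estimate and
the Borel–Cantelli lemma, almost every path does so when `τ n = 1 - δ 2⁻ⁿ` and `ε n` is of order
`(τ (n + 1) - τ n) ^ (2 α)`.
-/

section

open Set
open scoped NNReal

theorem intervalIntegrable_sub_rpow {r : ℝ} (hr : -1 < r) (a x : ℝ) :
    IntervalIntegrable (fun u => (x - u) ^ r) volume a x := by
  simpa using (intervalIntegral.intervalIntegrable_rpow' (a := x - a) (b := 0) hr).comp_sub_left x

theorem integral_sub_rpow {r : ℝ} (hr : -1 < r) (a x : ℝ) :
    ∫ u in a..x, (x - u) ^ r = (x - a) ^ (r + 1) / (r + 1) := by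
  rw [intervalIntegral.integral_comp_sub_left (fun y : ℝ => y ^ r) x, integral_rpow (Or.inl hr),
    sub_self, Real.zero_rpow (by linarith), sub_zero]

theorem integral_rpow_mul_sub_rpow {μ ν : ℝ} (hμ : 0 < μ) (hν : 0 < ν) {x : ℝ} (hx : 0 < x) :
    ∫ y in 0..x, y ^ (μ - 1) * (x - y) ^ (ν - 1) =
      x ^ (μ + ν - 1) * (Real.Gamma μ * Real.Gamma ν / Real.Gamma (μ + ν)) := by
  have hcomplex := Complex.betaIntegral_scaled μ ν hx
  rw [Complex.betaIntegral_eq_Gamma_mul_div _ _ hμ hν] at hcomplex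
  have hcast : ∫ y in 0..x, (y : ℂ) ^ ((μ : ℂ) - 1) * ((x : ℂ) - y) ^ ((ν : ℂ) - 1) =
      ∫ y in 0..x, ((y ^ (μ - 1) * (x - y) ^ (ν - 1) : ℝ) : ℂ) := by
    refine intervalIntegral.integral_congr fun y hy => ?_
    rw [uIcc_of_le hx.le] at hy
    simp only [Complex.ofReal_mul, Complex.ofReal_cpow hy.1,
      Complex.ofReal_cpow (sub_nonneg.2 hy.2), Complex.ofReal_sub, Complex.ofReal_one]
  rw [hcast, intervalIntegral.integral_ofReal, ← Complex.ofReal_add] at hcomplex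
  simp only [Complex.Gamma_ofReal, ← Complex.ofReal_one, ← Complex.ofReal_sub,
    ← Complex.ofReal_cpow hx.le] at hcomplex
  exact_mod_cast hcomplex

theorem integral_sub_rpow_mul_sub_rpow {μ ν : ℝ} (hμ : 0 < μ) (hν : 0 < ν) {a x : ℝ}
    (hax : a < x) :
    ∫ y in a..x, (y - a) ^ (μ - 1) * (x - y) ^ (ν - 1) =
      (x - a) ^ (μ + ν - 1) * (Real.Gamma μ * Real.Gamma ν / Real.Gamma (μ + ν)) := by
  rw [← integral_rpow_mul_sub_rpow hμ hν (sub_pos.2 hax)]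
  simpa only [sub_sub_sub_cancel_right, sub_self] using intervalIntegral.integral_comp_sub_right
    (a := a) (b := x) (fun y => y ^ (μ - 1) * (x - a - y) ^ (ν - 1)) a

/-- The left-sided Riemann–Liouville fractional integral `I_{a+}^μ p` of order `μ`. -/
noncomputable def leftFracIntegral (a μ : ℝ) (p : ℝ → ℝ) (x : ℝ) : ℝ :=
  (1 / Real.Gamma μ) * ∫ u in a..x, (x - u) ^ (μ - 1) * p u

/-- The right-sided Riemann–Liouville fractional integral `I_{b-}^μ q` of order `μ`. -/
noncomputable def rightFracIntegral (b μ : ℝ) (q : ℝ → ℝ) (x : ℝ) : ℝ :=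
  (1 / Real.Gamma μ) * ∫ v in x..b, (v - x) ^ (μ - 1) * q v

theorem leftFracIntegral_congr {a x : ℝ} {p p' : ℝ → ℝ} (h : ∀ u ∈ Ioo a x, p u = p' u)
    (hax : a ≤ x) (μ : ℝ) : leftFracIntegral a μ p x = leftFracIntegral a μ p' x := by
  rw [leftFracIntegral, leftFracIntegral]
  congr 1
  exact intervalIntegral.integral_congr_Ioo_of_le hax fun u hu => by simp only [h u hu]

theorem leftFracIntegral_one (a : ℝ) (p : ℝ → ℝ) (x : ℝ) :
    leftFracIntegral a 1 p x = ∫ u in a..x, p u := by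
  simp [leftFracIntegral]

theorem rightFracIntegral_eq_leftFracIntegral_neg (b μ : ℝ) (q : ℝ → ℝ) (x : ℝ) :
    rightFracIntegral b μ q x = leftFracIntegral (-b) μ (fun y => q (-y)) (-x) := by
  unfold rightFracIntegral leftFracIntegral
  rw [← intervalIntegral.integral_comp_neg]
  simp only [neg_neg, neg_sub_neg]

theorem rightFracIntegral_rpow {μ ν : ℝ} (hμ : 0 < μ) (hν : 0 < ν) {u x : ℝ} (hux : u < x) :
    rightFracIntegral x ν (fun y => (x - y) ^ (μ - 1)) u =
      Real.Gamma μ / Real.Gamma (μ + ν) * (x - u) ^ (μ + ν - 1) := by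
  rw [rightFracIntegral, integral_sub_rpow_mul_sub_rpow hν hμ hux, add_comm ν μ]
  have := (Real.Gamma_pos_of_pos hν).ne'
  field_simp

theorem integral_integral_triangle {a b : ℝ} (hab : a ≤ b) {F : ℝ → ℝ → ℝ}
    (hF : Integrable ({z : ℝ × ℝ | a < z.1 ∧ z.1 ≤ z.2 ∧ z.2 ≤ b}.indicator (Function.uncurry F))
      (volume.prod volume)) :
    ∫ x in a..b, ∫ u in a..x, F u x = ∫ u in a..b, ∫ x in u..b, F u x := by
  set T : Set (ℝ × ℝ) := {z | a < z.1 ∧ z.1 ≤ z.2 ∧ z.2 ≤ b} with hT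
  have hleft : ∀ x, ∫ u, T.indicator (Function.uncurry F) (u, x) =
      (Ioc a b).indicator (fun x => ∫ u in a..x, F u x) x := by
    intro x
    by_cases hx : x ∈ Ioc a b
    · rw [indicator_of_mem hx, intervalIntegral.integral_of_le hx.1.le,
        ← integral_indicator measurableSet_Ioc]
      congr 1 with u
      simp [indicator, hT, hx.2]
    · rw [indicator_of_notMem hx]
      refine integral_eq_zero_of_ae (Eventually.of_forall fun u => indicator_of_notMem ?_ _)
      exact fun h => hx ⟨h.1.trans_le h.2.1, h.2.2⟩
  have hright : ∀ u, ∫ x, T.indicator (Function.uncurry F) (u, x) =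
      (Ioc a b).indicator (fun u => ∫ x in u..b, F u x) u := by
    intro u
    by_cases hu : u ∈ Ioc a b
    · rw [indicator_of_mem hu, intervalIntegral.integral_of_le hu.2, ← integral_Icc_eq_integral_Ioc,
        ← integral_indicator measurableSet_Icc]
      congr 1 with x
      simp [indicator, hT, hu.1]
    · rw [indicator_of_notMem hu]
      refine integral_eq_zero_of_ae (Eventually.of_forall fun x => indicator_of_notMem ?_ _)
      exact fun h => hu ⟨h.1, h.2.1.trans h.2.2⟩
  have hswap := integral_integral_swap (f := fun u x => T.indicator (Function.uncurry F) (u, x)) hF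
  simp only [hleft, hright, integral_indicator measurableSet_Ioc] at hswap
  rw [intervalIntegral.integral_of_le hab, intervalIntegral.integral_of_le hab, hswap]

theorem integrable_triangle_sub_rpow {a b r : ℝ} (hr : -1 < r) {p q : ℝ → ℝ}
    (hp : ContinuousOn p (Icc a b)) (hq : IntervalIntegrable q volume a b) :
    Integrable ({z : ℝ × ℝ | a < z.1 ∧ z.1 ≤ z.2 ∧ z.2 ≤ b}.indicator
      (Function.uncurry fun u x => p u * (q x * (x - u) ^ r))) (volume.prod volume) := by
  set k : ℝ → ℝ := (Ioc (a - b) 0).indicator fun t => (-t) ^ r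
  have hk : Integrable k := by
    refine (integrable_indicator_iff measurableSet_Ioc).2 ?_
    simpa using (intervalIntegrable_sub_rpow hr (a - b) 0).1
  obtain ⟨M, hM⟩ := isCompact_Icc.exists_bound_of_continuousOn hp
  have hconv : Integrable (fun z : ℝ × ℝ => (Ioc a b).indicator q z.2 * k (z.1 - z.2))
      (volume.prod volume) :=
    ((integrable_indicator_iff measurableSet_Ioc).2 hq.1).convolution_integrand
      (ContinuousLinearMap.mul ℝ ℝ) hk
  have hprod : Integrable (fun z : ℝ × ℝ => (Ioc a b).indicator p z.1 *
      ((Ioc a b).indicator q z.2 * k (z.1 - z.2))) (volume.prod volume) := by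
    refine hconv.bdd_mul (c := |M|) ?_ (Eventually.of_forall fun z => ?_)
    · exact ((aestronglyMeasurable_indicator_iff measurableSet_Ioc).2
        ((hp.mono Ioc_subset_Icc_self).aestronglyMeasurable measurableSet_Ioc)).comp_fst
    · by_cases hz : z.1 ∈ Ioc a b
      · simpa [hz] using (hM _ (Ioc_subset_Icc_self hz)).trans (le_abs_self M)
      · simp [hz]
  refine hprod.congr (Eventually.of_forall fun z => ?_)
  simp only [indicator, mem_Ioc, mem_ofPred_eq, Function.uncurry, k, neg_sub]
  grind

theorem integral_leftFracIntegral_mul {a b μ : ℝ} (hab : a ≤ b) (hμ : 0 < μ) {p q : ℝ → ℝ}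
    (hp : ContinuousOn p (Icc a b)) (hq : IntervalIntegrable q volume a b) :
    ∫ x in a..b, leftFracIntegral a μ p x * q x = ∫ x in a..b, p x * rightFracIntegral b μ q x := by
  have hswap := integral_integral_triangle hab
    (integrable_triangle_sub_rpow (r := μ - 1) (by linarith) hp hq)
  calc ∫ x in a..b, leftFracIntegral a μ p x * q x
      = (1 / Real.Gamma μ) * ∫ x in a..b, ∫ u in a..x, p u * (q x * (x - u) ^ (μ - 1)) := by
        simp only [leftFracIntegral, ← intervalIntegral.integral_const_mul,
          ← intervalIntegral.integral_mul_const]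
        congr! 4
        ring
    _ = (1 / Real.Gamma μ) * ∫ u in a..b, ∫ x in u..b, p u * (q x * (x - u) ^ (μ - 1)) := by
        rw [hswap]
    _ = ∫ u in a..b, p u * rightFracIntegral b μ q u := by
        simp only [rightFracIntegral, ← intervalIntegral.integral_const_mul]
        congr! 4
        ring

theorem leftFracIntegral_leftFracIntegral {a x μ ν : ℝ} (hax : a ≤ x) (hμ : 0 < μ) (hν : 0 < ν)
    {p : ℝ → ℝ} (hp : ContinuousOn p (Icc a x)) :
    leftFracIntegral a μ (leftFracIntegral a ν p) x = leftFracIntegral a (μ + ν) p x := by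
  have hparts := integral_leftFracIntegral_mul hax hν hp
    (intervalIntegrable_sub_rpow (r := μ - 1) (by linarith) a x)
  have hμΓ := (Real.Gamma_pos_of_pos hμ).ne'
  calc leftFracIntegral a μ (leftFracIntegral a ν p) x
      = (1 / Real.Gamma μ) * ∫ u in a..x, p u * rightFracIntegral x ν
          (fun y => (x - y) ^ (μ - 1)) u := by
        rw [← hparts, leftFracIntegral]
        simp only [mul_comm]
    _ = (1 / Real.Gamma μ) * ∫ u in a..x, Real.Gamma μ / Real.Gamma (μ + ν) *
          ((x - u) ^ (μ + ν - 1) * p u) := by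
        congr 1
        refine intervalIntegral.integral_congr_Ioo_of_le hax fun u hu => ?_
        simp only [rightFracIntegral_rpow hμ hν hu.2]
        ring
    _ = leftFracIntegral a (μ + ν) p x := by
        rw [intervalIntegral.integral_const_mul, leftFracIntegral]
        field_simp

section Holder

variable {f g : ℝ → ℝ} {C r : ℝ≥0} {a b β : ℝ}

theorem abs_sub_le_of_holderOnWith (hf : HolderOnWith C r f (Icc a b)) {x u : ℝ}
    (hx : x ∈ Icc a b) (hu : u ∈ Icc a b) : |f x - f u| ≤ C * |x - u| ^ (r : ℝ) :=
  hf.dist_le hx hu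

theorem abs_div_sub_rpow_le_of_holderOnWith (hf : HolderOnWith C r f (Icc a b)) {x u : ℝ}
    (hx : x ∈ Icc a b) (hu : u ∈ Icc a x) (γ : ℝ) :
    |(f x - f u) / (x - u) ^ γ| ≤ C * (x - u) ^ (r - γ) := by
  rcases hu.2.eq_or_lt with rfl | hux
  · simp only [sub_self, zero_div, abs_zero]
    positivity
  have hpos : 0 < x - u := sub_pos.2 hux
  rw [abs_div, abs_of_pos (Real.rpow_pos_of_pos hpos γ), div_le_iff₀ (Real.rpow_pos_of_pos hpos γ),
    mul_assoc, ← Real.rpow_add hpos, sub_add_cancel, ← abs_of_pos hpos]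
  simpa using abs_sub_le_of_holderOnWith hf hx ⟨hu.1, hu.2.trans hx.2⟩

theorem intervalIntegrable_div_sub_rpow_of_holderOnWith (hf : HolderOnWith C r f (Icc a b))
    (hβ : 0 < β) (hr : β < r) {x : ℝ} (hx : x ∈ Icc a b) :
    IntervalIntegrable (fun u => (f x - f u) / (x - u) ^ (β + 1)) volume a x := by
  refine ((intervalIntegrable_sub_rpow (r := r - (β + 1)) (by linarith) a x).const_mul C).mono_fun'
    ?_ ?_ <;> rw [uIoc_of_le hx.1]
  · have hcont : ContinuousOn f (Ioc a x) := (hf.continuousOn (by exact_mod_cast hβ.trans hr)).mono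
      fun u hu => ⟨hu.1.le, hu.2.trans hx.2⟩
    have := hcont.aestronglyMeasurable (μ := volume) measurableSet_Ioc
    refine (aestronglyMeasurable_const.sub this).aemeasurable.div ?_ |>.aestronglyMeasurable
    exact Measurable.aemeasurable (by fun_prop)
  · filter_upwards [ae_restrict_mem measurableSet_Ioc] with u hu
    exact abs_div_sub_rpow_le_of_holderOnWith hf hx (Ioc_subset_Icc_self hu) _

theorem abs_leftFracDeriv_le (hf : HolderOnWith C r f (Icc a b)) (hβ : 0 < β) (hβ1 : β < 1)
    (hr : β < r) (hfa : f a = 0) {x : ℝ} (hx : x ∈ Icc a b) :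
    |leftFracDeriv a β f x| ≤
      1 / Real.Gamma (1 - β) * (C * r / (r - β) * (x - a) ^ (r - β)) := by
  have hΓ : 0 < Real.Gamma (1 - β) := Real.Gamma_pos_of_pos (by linarith)
  have hboundary : |f x / (x - a) ^ β| ≤ C * (x - a) ^ (r - β) := by
    simpa [hfa] using abs_div_sub_rpow_le_of_holderOnWith hf hx (left_mem_Icc.2 hx.1) β
  have hinner : |∫ u in a..x, (f x - f u) / (x - u) ^ (β + 1)| ≤
      C * ((x - a) ^ (r - β) / (r - β)) := by
    have h := intervalIntegral.norm_integral_le_of_norm_le (μ := volume) hx.1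
      (f := fun u => (f x - f u) / (x - u) ^ (β + 1)) (ae_of_all _ fun u hu =>
        abs_div_sub_rpow_le_of_holderOnWith hf hx (Ioc_subset_Icc_self hu) (β + 1))
      ((intervalIntegrable_sub_rpow (by linarith) a x).const_mul C)
    rwa [intervalIntegral.integral_const_mul, integral_sub_rpow (by linarith),
      show (r : ℝ) - (β + 1) + 1 = r - β by ring] at h
  have hrβ : (0 : ℝ) < r - β := by linarith
  calc |leftFracDeriv a β f x|
      ≤ 1 / Real.Gamma (1 - β) * (|f x / (x - a) ^ β| +
          β * |∫ u in a..x, (f x - f u) / (x - u) ^ (β + 1)|) := by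
        rw [leftFracDeriv, abs_mul, abs_of_pos (one_div_pos.2 hΓ)]
        gcongr
        exact (abs_add_le _ _).trans_eq (by rw [abs_mul, abs_of_pos hβ])
    _ ≤ 1 / Real.Gamma (1 - β) *
          (C * (x - a) ^ (r - β) + β * (C * ((x - a) ^ (r - β) / (r - β)))) := by
        gcongr
    _ = _ := by field_simp; ring

theorem abs_leftFracDeriv_le_uniform (hf : HolderOnWith C r f (Icc a b)) (hβ : 0 < β)
    (hβ1 : β < 1) (hr : β < r) (hfa : f a = 0) {x : ℝ} (hx : x ∈ Icc a b) :
    |leftFracDeriv a β f x| ≤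
      1 / Real.Gamma (1 - β) * (C * r / (r - β) * (b - a) ^ (r - β)) := by
  refine (abs_leftFracDeriv_le hf hβ hβ1 hr hfa hx).trans ?_
  have : 0 < Real.Gamma (1 - β) := Real.Gamma_pos_of_pos (by linarith)
  have : (0 : ℝ) < r - β := by linarith
  have hxa : 0 ≤ x - a := sub_nonneg.2 hx.1
  have hxb := hx.2
  gcongr

theorem leftFracDeriv_congr {x : ℝ} (hax : a ≤ x) (h : EqOn f g (Icc a x)) (β : ℝ) :
    leftFracDeriv a β f x = leftFracDeriv a β g x := by
  rw [leftFracDeriv, leftFracDeriv, h (right_mem_Icc.2 hax)]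
  congr 3
  refine intervalIntegral.integral_congr fun u hu => ?_
  simp only [h (uIcc_of_le hax ▸ hu)]

theorem measurable_leftFracDeriv (hf : Measurable f) (a β : ℝ) :
    Measurable (leftFracDeriv a β f) := by
  have hscale : ∀ x, ∫ u in a..x, (f x - f u) / (x - u) ^ (β + 1) = (x - a) *
      ∫ s in 0..1, (f x - f (a + (x - a) * s)) / (x - (a + (x - a) * s)) ^ (β + 1) := by
    intro x
    rw [intervalIntegral.mul_integral_comp_add_mul
      (f := fun u => (f x - f u) / (x - u) ^ (β + 1))]
    simp
  have hinner : Measurable fun x => ∫ s in 0..1,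
      (f x - f (a + (x - a) * s)) / (x - (a + (x - a) * s)) ^ (β + 1) := by
    simp only [intervalIntegral.integral_of_le zero_le_one]
    refine (StronglyMeasurable.integral_prod_right ?_).measurable
    exact Measurable.stronglyMeasurable (by unfold Function.uncurry; fun_prop)
  unfold leftFracDeriv
  simp only [hscale]
  fun_prop

theorem aestronglyMeasurable_leftFracDeriv (hf : ContinuousOn f (Icc a b)) (hab : a ≤ b) (β : ℝ) :
    AEStronglyMeasurable (leftFracDeriv a β f) (volume.restrict (Ioc a b)) := by
  have hext : Continuous (IccExtend hab ((Icc a b).domRestrict f)) :=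
    (continuousOn_iff_continuous_domRestrict.1 hf).Icc_extend'
  refine (measurable_leftFracDeriv hext.measurable a β).aestronglyMeasurable.congr ?_
  filter_upwards [ae_restrict_mem measurableSet_Ioc] with x hx
  refine leftFracDeriv_congr hx.1.le (fun u hu => ?_) β
  exact IccExtend_of_mem hab _ ⟨hu.1, hu.2.trans hx.2⟩

theorem memLp_top_leftFracDeriv (hf : HolderOnWith C r f (Icc a b)) (hβ : 0 < β) (hβ1 : β < 1)
    (hr : β < r) (hfa : f a = 0) (hab : a ≤ b) :
    MemLp (leftFracDeriv a β f) ⊤ (volume.restrict (Ioc a b)) := by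
  have hcont := hf.continuousOn (by exact_mod_cast hβ.trans hr)
  exact memLp_top_of_bound (aestronglyMeasurable_leftFracDeriv hcont hab β) _
    ((ae_restrict_mem measurableSet_Ioc).mono fun x hx =>
      abs_leftFracDeriv_le_uniform hf hβ hβ1 hr hfa (Ioc_subset_Icc_self hx))

theorem rightFracDeriv_eq_leftFracDeriv_neg (b β : ℝ) (g : ℝ → ℝ) (x : ℝ) :
    rightFracDeriv b β g x = leftFracDeriv (-b) β (fun y => g (-y)) (-x) := by
  unfold rightFracDeriv leftFracDeriv
  rw [← intervalIntegral.integral_comp_neg]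
  simp only [neg_neg, sub_neg_eq_add, neg_add_eq_sub]

theorem holderOnWith_comp_neg_sub_const (hg : HolderOnWith C r g (Icc a b)) (c : ℝ) :
    HolderOnWith C r (fun y => g (-y) - c) (Icc (-b) (-a)) := by
  intro x hx y hy
  simpa using hg (-x) ⟨le_neg.2 hx.2, neg_le.2 hx.1⟩ (-y) ⟨le_neg.2 hy.2, neg_le.2 hy.1⟩

theorem memLp_top_rightFracDeriv (hg : HolderOnWith C r g (Icc a b)) (hβ : 0 < β) (hβ1 : β < 1)
    (hr : β < r) (hab : a ≤ b) :
    MemLp (rightFracDeriv b β fun x => g x - g b) ⊤ (volume.restrict (Ioc a b)) := by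
  have hleft := memLp_top_leftFracDeriv (holderOnWith_comp_neg_sub_const hg (g b)) hβ hβ1 hr
    (by simp) (neg_le_neg hab)
  have hmp := (Measure.measurePreserving_neg (volume : Measure ℝ)).restrict_preimage
    (measurableSet_Ioc (a := -b) (b := -a))
  rw [neg_preimage, neg_Ioc, neg_neg, neg_neg, Measure.restrict_congr_set Ico_ae_eq_Ioc] at hmp
  refine (hleft.comp_measurePreserving hmp).ae_eq (ae_of_all _ fun x => ?_)
  exact (rightFracDeriv_eq_leftFracDeriv_neg b β (fun y => g y - g b) x).symm

theorem lintegral_div_sub_rpow_le_of_holderOnWith (hf : HolderOnWith C r f (Icc a b))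
    (hr : β < r) {x : ℝ} (hx : x ∈ Icc a b) :
    ∫⁻ u in Ioc a x, ENNReal.ofReal (|f x - f u| / (x - u) ^ (β + 1)) ≤
      ENNReal.ofReal (C * ((x - a) ^ (r - β) / (r - β))) := by
  have hkernel : IntervalIntegrable (fun u => C * (x - u) ^ (r - (β + 1))) volume a x :=
    (intervalIntegrable_sub_rpow (by linarith) a x).const_mul (C : ℝ)
  calc ∫⁻ u in Ioc a x, ENNReal.ofReal (|f x - f u| / (x - u) ^ (β + 1))
      ≤ ∫⁻ u in Ioc a x, ENNReal.ofReal (C * (x - u) ^ (r - (β + 1))) := by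
        refine setLIntegral_mono' measurableSet_Ioc fun u hu => ENNReal.ofReal_le_ofReal ?_
        simpa [abs_div, abs_of_nonneg (Real.rpow_nonneg (sub_nonneg.2 hu.2) _)] using
          abs_div_sub_rpow_le_of_holderOnWith hf hx (Ioc_subset_Icc_self hu) (β + 1)
    _ = ENNReal.ofReal (∫ u in Ioc a x, C * (x - u) ^ (r - (β + 1))) := by
        refine (ofReal_integral_eq_lintegral_ofReal hkernel.1 ?_).symm
        filter_upwards [ae_restrict_mem measurableSet_Ioc] with u hu
        exact mul_nonneg C.2 (Real.rpow_nonneg (sub_nonneg.2 hu.2) _)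
    _ = ENNReal.ofReal (C * ((x - a) ^ (r - β) / (r - β))) := by
        rw [← intervalIntegral.integral_of_le hx.1, intervalIntegral.integral_const_mul,
          integral_sub_rpow (by linarith), show (r : ℝ) - (β + 1) + 1 = r - β by ring]

theorem glsNorm_lt_top_of_holderOnWith (hf : HolderOnWith C r f (Icc a b)) (hr : β < r)
    (hfa : f a = 0) : glsNorm β f a b < ⊤ := by
  have : (0 : ℝ) < r - β := by linarith
  have hbound : ∀ t ∈ Ioc a b, (ENNReal.ofReal (|f t| / (t - a) ^ β) +
      ∫⁻ s in Ioc a t, ENNReal.ofReal (|f t - f s| / (t - s) ^ (β + 1))) ≤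
      ENNReal.ofReal (C * (b - a) ^ (r - β)) +
        ENNReal.ofReal (C * ((b - a) ^ (r - β) / (r - β))) := by
    intro t ht
    have ht' := Ioc_subset_Icc_self ht
    have hta : 0 ≤ t - a := sub_nonneg.2 ht'.1
    have htb := ht.2
    refine add_le_add (ENNReal.ofReal_le_ofReal ?_) ?_
    · have h := abs_div_sub_rpow_le_of_holderOnWith hf ht' (left_mem_Icc.2 ht'.1) β
      rw [hfa, sub_zero, abs_div, abs_of_nonneg (Real.rpow_nonneg hta β)] at h
      refine h.trans ?_
      gcongr
    · refine (lintegral_div_sub_rpow_le_of_holderOnWith hf hr ht').trans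
        (ENNReal.ofReal_le_ofReal ?_)
      gcongr
  refine (setLIntegral_mono' measurableSet_Ioc hbound).trans_lt ?_
  rw [setLIntegral_const]
  exact ENNReal.mul_lt_top (by finiteness) measure_Ioc_lt_top

theorem glsIntegrable_of_holderOnWith {C' α : ℝ≥0} (hf : HolderOnWith C r f (Icc a b))
    (hg : HolderOnWith C' α g (Icc a b)) (hβ : 0 < β) (hβ1 : β < 1) (hr : β < r) (hα : 1 - β < α)
    (hab : a ≤ b) (hfa : f a = 0) : GLSIntegrable β f g a b where
  norm_lt_top := glsNorm_lt_top_of_holderOnWith hf hr hfa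
  left_inner := by
    filter_upwards [ae_restrict_mem measurableSet_Ioc] with x hx
    exact intervalIntegrable_div_sub_rpow_of_holderOnWith hf hβ hr (Ioc_subset_Icc_self hx)
  left_memLp := (memLp_top_leftFracDeriv hf hβ hβ1 hr hfa hab).mono_exponent le_top
  right_inner := by
    filter_upwards [ae_restrict_mem measurableSet_Ioc] with x hx
    have h := intervalIntegrable_div_sub_rpow_of_holderOnWith
      (holderOnWith_comp_neg_sub_const hg 0) (sub_pos.2 hβ1) hα
      ⟨neg_le_neg hx.2, neg_le_neg hx.1.le⟩
    simpa [neg_add_eq_sub] using (h.comp_sub_left 0).symm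
  right_memLp := memLp_top_rightFracDeriv hg (sub_pos.2 hβ1) (by linarith) hα hab

end Holder

section ContDiff

variable {f : ℝ → ℝ} {a b β : ℝ}

theorem exists_holderOnWith_one_of_contDiffAt (hf : ∀ x ∈ Icc a b, ContDiffAt ℝ 1 f x) :
    ∃ K : ℝ≥0, HolderOnWith K 1 f (Icc a b) := by
  have hloc : LocallyLipschitzOn (Icc a b) f := fun x hx =>
    let ⟨K, t, ht, hK⟩ := (hf x hx).exists_lipschitzOnWith
    ⟨K, t, mem_nhdsWithin_of_mem_nhds ht, hK⟩
  obtain ⟨K, hK⟩ := hloc.exists_lipschitzOnWith_of_compact isCompact_Icc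
  exact ⟨K, hK.holderOnWith⟩

theorem continuousOn_deriv_of_contDiffAt (hf : ∀ x ∈ Icc a b, ContDiffAt ℝ 1 f x) :
    ContinuousOn (deriv f) (Icc a b) := fun x hx =>
  (((hf x hx).continuousAt_fderiv one_ne_zero).clm_apply continuousAt_const).continuousWithinAt

theorem continuousOn_div_sub_rpow_of_holderOnWith {C r : ℝ≥0} {x : ℝ}
    (hf : HolderOnWith C r f (Icc a x)) (hr : 0 < r) (hβ : β < r) :
    ContinuousOn (fun u => (f x - f u) / (x - u) ^ β) (Icc a x) := by
  intro u hu
  rcases hu.2.eq_or_lt with rfl | hux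
  · have hbound : Tendsto (fun v => C * (u - v) ^ (r - β)) (𝓝[Icc a u] u) (𝓝 0) := by
      have hcont : ContinuousAt (fun v => (C : ℝ) * (u - v) ^ (r - β)) u :=
        ContinuousAt.const_mul (by
          exact (continuousAt_const.sub continuousAt_id).rpow_const (Or.inr (by linarith))) _
      simpa [Real.zero_rpow (sub_pos.2 hβ).ne'] using hcont.tendsto.mono_left nhdsWithin_le_nhds
    rw [ContinuousWithinAt, sub_self, zero_div]
    refine squeeze_zero_norm' ?_ hbound
    filter_upwards [self_mem_nhdsWithin] with v hv using
      abs_div_sub_rpow_le_of_holderOnWith hf hu hv β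
  · have hpos : 0 < x - u := sub_pos.2 hux
    exact (continuousWithinAt_const.sub (hf.continuousOn hr u hu)).div
      ((continuousWithinAt_const.sub continuousWithinAt_id).rpow_const (Or.inl hpos.ne'))
      (Real.rpow_pos_of_pos hpos β).ne'

theorem leftFracDeriv_eq_leftFracIntegral_deriv (hf : ∀ x ∈ Icc a b, ContDiffAt ℝ 1 f x)
    (hfa : f a = 0) (hβ : 0 < β) (hβ1 : β < 1) {x : ℝ} (hx : x ∈ Icc a b) :
    leftFracDeriv a β f x = leftFracIntegral a (1 - β) (deriv f) x := by
  have hsub : Icc a x ⊆ Icc a b := Icc_subset_Icc_right hx.2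
  obtain ⟨K, hK⟩ := exists_holderOnWith_one_of_contDiffAt hf
  have hmarchaud : IntervalIntegrable (fun u => (f x - f u) / (x - u) ^ (β + 1)) volume a x :=
    intervalIntegrable_div_sub_rpow_of_holderOnWith hK hβ (by simpa using hβ1) hx
  have hriemann : IntervalIntegrable (fun u => (x - u) ^ (1 - β - 1) * deriv f u) volume a x :=
    (intervalIntegrable_sub_rpow (by linarith) a x).mul_continuousOn
      (by rw [uIcc_of_le hx.1]; exact (continuousOn_deriv_of_contDiffAt hf).mono hsub)
  have hderiv : ∀ u ∈ Ioo a x, HasDerivAt (fun u => (f x - f u) / (x - u) ^ β)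
      (β * ((f x - f u) / (x - u) ^ (β + 1)) - (x - u) ^ (1 - β - 1) * deriv f u) u := by
    intro u hu
    have hpos : 0 < x - u := sub_pos.2 hu.2
    have hfu := ((hf u (hsub (Ioo_subset_Icc_self hu))).differentiableAt one_ne_zero).hasDerivAt
    have hpow := ((hasDerivAt_id' u).const_sub x).rpow_const (p := β) (Or.inl hpos.ne')
    have hβpos := Real.rpow_pos_of_pos hpos β
    refine ((hfu.const_sub (f x)).div hpow hβpos.ne').congr_deriv ?_
    rw [Real.rpow_sub_one hpos.ne' β, Real.rpow_add_one hpos.ne', show 1 - β - 1 = -β by ring,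
      Real.rpow_neg hpos.le]
    field_simp
    ring
  have hparts := intervalIntegral.integral_eq_sub_of_hasDerivAt_of_le hx.1
    (continuousOn_div_sub_rpow_of_holderOnWith (hK.mono hsub) one_pos (by simpa using hβ1)) hderiv
    ((hmarchaud.const_mul β).sub hriemann)
  rw [intervalIntegral.integral_sub (hmarchaud.const_mul β) hriemann,
    intervalIntegral.integral_const_mul, sub_self, zero_div, hfa, sub_zero] at hparts
  rw [leftFracDeriv, leftFracIntegral]
  congr 1
  linarith

theorem leftFracIntegral_leftFracDeriv_of_contDiffAt (hf : ∀ x ∈ Icc a b, ContDiffAt ℝ 1 f x)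
    (hfa : f a = 0) (hβ : 0 < β) (hβ1 : β < 1) {x : ℝ} (hx : x ∈ Icc a b) :
    leftFracIntegral a β (leftFracDeriv a β f) x = f x := by
  have hsub : Icc a x ⊆ Icc a b := Icc_subset_Icc_right hx.2
  have hcont := (continuousOn_deriv_of_contDiffAt hf).mono hsub
  calc leftFracIntegral a β (leftFracDeriv a β f) x
      = leftFracIntegral a β (leftFracIntegral a (1 - β) (deriv f)) x :=
        leftFracIntegral_congr (fun u hu => leftFracDeriv_eq_leftFracIntegral_deriv hf hfa hβ hβ1
          (hsub (Ioo_subset_Icc_self hu))) hx.1 β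
    _ = leftFracIntegral a 1 (deriv f) x := by
        rw [leftFracIntegral_leftFracIntegral hx.1 hβ (sub_pos.2 hβ1) hcont, add_sub_cancel]
    _ = f x := by
        rw [leftFracIntegral_one, intervalIntegral.integral_deriv_eq_sub, hfa, sub_zero]
        · rw [uIcc_of_le hx.1]
          exact fun u hu => (hf u (hsub hu)).differentiableAt one_ne_zero
        · exact (uIcc_of_le hx.1 ▸ hcont).intervalIntegrable

end ContDiff

section Steklov

theorem holderOnWith_of_abs_sub_le {f : ℝ → ℝ} {C r : ℝ≥0} {s : Set ℝ}
    (hf : ∀ x ∈ s, ∀ y ∈ s, |f x - f y| ≤ C * |x - y| ^ (r : ℝ)) : HolderOnWith C r f s := by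
  intro x hx y hy
  rw [edist_dist, edist_dist, ENNReal.ofReal_rpow_of_nonneg dist_nonneg r.coe_nonneg,
    ← ENNReal.ofReal_coe_nnreal, ← ENNReal.ofReal_mul C.coe_nonneg]
  exact ENNReal.ofReal_le_ofReal (hf x hx y hy)

/-- The Steklov mean of `g` over `[x, x + h]`, normalised by the substitution `t = x + h s`; these
means are continuously differentiable approximations of `g` with the same Hölder constant. -/
noncomputable def steklovMean (g : ℝ → ℝ) (h x : ℝ) : ℝ :=
  ∫ s in 0..1, g (x + h * s)

variable {g : ℝ → ℝ} {C r : ℝ≥0}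

theorem contDiff_steklovMean (hg : Continuous g) {h : ℝ} (hh : h ≠ 0) :
    ContDiff ℝ 1 (steklovMean g h) := by
  have hprimitive : ContDiff ℝ 1 fun x => ∫ t in 0..x, g t := by
    refine contDiff_one_iff_deriv.2 ⟨fun x => ?_, ?_⟩
    · exact (hg.integral_hasStrictDerivAt 0 x).hasDerivAt.differentiableAt
    · simpa only [funext fun x => hg.deriv_integral g 0 x] using hg
  have hmean : steklovMean g h = fun x => h⁻¹ * ((∫ t in 0..x + h, g t) - ∫ t in 0..x, g t) := by
    ext x
    rw [steklovMean, intervalIntegral.integral_comp_add_mul g hh,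
      intervalIntegral.integral_interval_sub_left (hg.intervalIntegrable _ _)
        (hg.intervalIntegrable _ _)]
    simp
  rw [hmean]
  fun_prop

theorem abs_steklovMean_sub_steklovMean_le (hg : HolderWith C r g) (hr : 0 < r) (h x y : ℝ) :
    |steklovMean g h x - steklovMean g h y| ≤ C * |x - y| ^ (r : ℝ) := by
  have hcont := hg.continuous hr
  rw [steklovMean, steklovMean, ← intervalIntegral.integral_sub]
  · have hbound := intervalIntegral.norm_integral_le_of_norm_le_const (a := 0) (b := 1)
      (f := fun s => g (x + h * s) - g (y + h * s)) (C := C * |x - y| ^ (r : ℝ)) fun s _ => by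
        simpa [Real.dist_eq] using hg.dist_le (x + h * s) (y + h * s)
    simpa using hbound
  all_goals exact Continuous.intervalIntegrable (by fun_prop) _ _

theorem tendsto_steklovMean (hg : Continuous g) (x : ℝ) :
    Tendsto (fun h => steklovMean g h x) (𝓝[>] 0) (𝓝 (g x)) := by
  have hcont : Continuous fun h => steklovMean g h x :=
    intervalIntegral.continuous_parametric_intervalIntegral_of_continuous' (μ := volume)
      (f := fun h s => g (x + h * s)) (by unfold Function.uncurry; fun_prop) 0 1
  simpa [steklovMean] using (hcont.tendsto 0).mono_left nhdsWithin_le_nhds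

end Steklov

section Inversion

variable {ι : Type*} {l : Filter ι} [l.IsCountablyGenerated] {F : ι → ℝ → ℝ} {f : ℝ → ℝ}
  {C r : ℝ≥0} {a b β x : ℝ}

theorem tendsto_leftFracDeriv (hF : ∀ᶠ i in l, HolderOnWith C r (F i) (Icc a b))
    (hlim : ∀ u ∈ Icc a b, Tendsto (F · u) l (𝓝 (f u))) (hβ : 0 < β) (hr : β < r)
    (hx : x ∈ Icc a b) :
    Tendsto (fun i => leftFracDeriv a β (F i) x) l (𝓝 (leftFracDeriv a β f x)) := by
  have hinner : Tendsto (fun i => ∫ u in a..x, (F i x - F i u) / (x - u) ^ (β + 1)) l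
      (𝓝 (∫ u in a..x, (f x - f u) / (x - u) ^ (β + 1))) := by
    refine intervalIntegral.tendsto_integral_filter_of_dominated_convergence
      (fun u => C * (x - u) ^ (r - (β + 1))) ?_ ?_
      ((intervalIntegrable_sub_rpow (by linarith) a x).const_mul _) ?_
    · filter_upwards [hF] with i hi
      exact (intervalIntegrable_div_sub_rpow_of_holderOnWith hi hβ hr hx).def'.aestronglyMeasurable
    · filter_upwards [hF] with i hi
      refine ae_of_all _ fun u hu => ?_
      rw [uIoc_of_le hx.1] at hu
      exact abs_div_sub_rpow_le_of_holderOnWith hi hx (Ioc_subset_Icc_self hu) _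
    · refine ae_of_all _ fun u hu => ?_
      rw [uIoc_of_le hx.1] at hu
      exact ((hlim x hx).sub (hlim u ⟨hu.1.le, hu.2.trans hx.2⟩)).div_const _
  exact (((hlim x hx).div_const _).add (hinner.const_mul β)).const_mul _

theorem tendsto_leftFracIntegral (hβ : 0 < β) (hax : a ≤ x) {K : ℝ}
    (hmeas : ∀ᶠ i in l, AEStronglyMeasurable (F i) (volume.restrict (Ioc a x)))
    (hK : ∀ᶠ i in l, ∀ u ∈ Ioc a x, |F i u| ≤ K)
    (hlim : ∀ u ∈ Ioc a x, Tendsto (F · u) l (𝓝 (f u))) :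
    Tendsto (fun i => leftFracIntegral a β (F i) x) l (𝓝 (leftFracIntegral a β f x)) := by
  refine (intervalIntegral.tendsto_integral_filter_of_dominated_convergence
    (fun u => (x - u) ^ (β - 1) * K) ?_ ?_
    ((intervalIntegrable_sub_rpow (by linarith) a x).mul_const _) ?_).const_mul _ <;>
    rw [uIoc_of_le hax]
  · filter_upwards [hmeas] with i hi
    exact (Measurable.aestronglyMeasurable (by fun_prop)).mul hi
  · filter_upwards [hK] with i hi
    refine ae_of_all _ fun u hu => ?_
    rw [norm_mul, Real.norm_of_nonneg (Real.rpow_nonneg (sub_nonneg.2 hu.2) _)]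
    exact mul_le_mul_of_nonneg_left (hi u hu) (Real.rpow_nonneg (sub_nonneg.2 hu.2) _)
  · exact ae_of_all _ fun u hu => (hlim u hu).const_mul _

theorem leftFracIntegral_leftFracDeriv_of_holderWith (hf : HolderWith C r f) (hβ : 0 < β)
    (hβ1 : β < 1) (hr : β < r) (hfa : f a = 0) (hax : a ≤ x) :
    leftFracIntegral a β (leftFracDeriv a β f) x = f x := by
  have hr0 : 0 < r := by exact_mod_cast hβ.trans hr
  have hcont := hf.continuous hr0
  set F : ℝ → ℝ → ℝ := fun h u => steklovMean f h u - steklovMean f h a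
  have hF : ∀ h, HolderOnWith C r (F h) (Icc a x) := fun h =>
    holderOnWith_of_abs_sub_le fun u _ v _ => by
      simpa [F] using abs_steklovMean_sub_steklovMean_le hf hr0 h u v
  have hFa : ∀ h, F h a = 0 := fun h => sub_self _
  have hlim : ∀ u, Tendsto (F · u) (𝓝[>] 0) (𝓝 (f u)) := fun u => by
    simpa [F, hfa] using (tendsto_steklovMean hcont u).sub (tendsto_steklovMean hcont a)
  have hinv : ∀ᶠ h in 𝓝[>] 0, leftFracIntegral a β (leftFracDeriv a β (F h)) x = F h x := by
    filter_upwards [self_mem_nhdsWithin] with h hh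
    exact leftFracIntegral_leftFracDeriv_of_contDiffAt (b := x)
      (fun u _ => ((contDiff_steklovMean hcont (ne_of_gt hh)).sub contDiff_const).contDiffAt)
      (hFa h) hβ hβ1 (right_mem_Icc.2 hax)
  have hlim_left := tendsto_leftFracIntegral (l := 𝓝[>] 0) hβ hax
    (Eventually.of_forall fun h =>
      aestronglyMeasurable_leftFracDeriv ((hF h).continuousOn hr0) hax β)
    (Eventually.of_forall fun h u hu =>
      abs_leftFracDeriv_le_uniform (hF h) hβ hβ1 hr (hFa h) (Ioc_subset_Icc_self hu))
    (fun u hu => tendsto_leftFracDeriv (Eventually.of_forall hF) (fun v _ => hlim v) hβ hr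
      (Ioc_subset_Icc_self hu))
  exact tendsto_nhds_unique (hlim_left.congr' hinv) (hlim x)

theorem leftFracIntegral_leftFracDeriv (hf : HolderOnWith C r f (Icc a b)) (hβ : 0 < β)
    (hβ1 : β < 1) (hr : β < r) (hfa : f a = 0) (hx : x ∈ Icc a b) :
    leftFracIntegral a β (leftFracDeriv a β f) x = f x := by
  have hab : a ≤ b := hx.1.trans hx.2
  set f' : ℝ → ℝ := IccExtend hab ((Icc a b).domRestrict f)
  have hf' : HolderWith C r f' := by
    simpa [f', IccExtend] using
      (HolderWith.restrict_iff.2 hf).comp (holderWith_one.2 (LipschitzWith.projIcc hab))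
  have hff' : EqOn f f' (Icc a b) := fun u hu =>
    (IccExtend_of_mem hab ((Icc a b).domRestrict f) hu).symm
  rw [hff' hx, ← leftFracIntegral_leftFracDeriv_of_holderWith hf' hβ hβ1 hr
    ((hff' (left_mem_Icc.2 hab)).symm.trans hfa) hx.1]
  refine leftFracIntegral_congr (fun u hu => leftFracDeriv_congr hu.1.le (fun v hv => ?_) β) hx.1 β
  exact hff' ⟨hv.1, hv.2.trans (hu.2.le.trans hx.2)⟩

theorem rightFracIntegral_rightFracDeriv (hf : HolderOnWith C r f (Icc a b)) (hβ : 0 < β)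
    (hβ1 : β < 1) (hr : β < r) (hx : x ∈ Icc a b) :
    rightFracIntegral b β (rightFracDeriv b β fun y => f y - f b) x = f x - f b := by
  have hleft := leftFracIntegral_leftFracDeriv (holderOnWith_comp_neg_sub_const hf (f b)) hβ hβ1 hr
    (by simp) ⟨neg_le_neg hx.2, neg_le_neg hx.1⟩
  rw [neg_neg] at hleft
  simpa only [rightFracIntegral_eq_leftFracIntegral_neg, rightFracDeriv_eq_leftFracDeriv_neg,
    neg_neg] using hleft

end Inversion

theorem glsIntegral_eq_integral_deriv_mul {f g : ℝ → ℝ} {C α : ℝ≥0} {a b β : ℝ} (hab : a ≤ b)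
    (hf : ∀ x ∈ Icc a b, ContDiffAt ℝ 1 f x) (hfa : f a = 0) (hg : HolderOnWith C α g (Icc a b))
    (hβ : 0 < β) (hβ1 : β < 1) (hα : 1 - β < α) :
    glsIntegral β f g a b = ∫ x in a..b, deriv f x * (g b - g x) := by
  have hright : IntervalIntegrable (rightFracDeriv b (1 - β) fun y => g y - g b) volume a b :=
    (intervalIntegrable_iff_integrableOn_Ioc_of_le hab).2
      ((memLp_top_rightFracDeriv hg (sub_pos.2 hβ1) (by linarith) hα hab).integrable le_top)
  calc glsIntegral β f g a b
      = -∫ x in a..b, leftFracIntegral a (1 - β) (deriv f) x *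
          rightFracDeriv b (1 - β) (fun y => g y - g b) x := by
        rw [glsIntegral]
        congr 1
        refine intervalIntegral.integral_congr fun x hx => ?_
        rw [uIcc_of_le hab] at hx
        simp only [leftFracDeriv_eq_leftFracIntegral_deriv hf hfa hβ hβ1 hx]
    _ = -∫ x in a..b, deriv f x *
          rightFracIntegral b (1 - β) (rightFracDeriv b (1 - β) fun y => g y - g b) x := by
        rw [integral_leftFracIntegral_mul hab (sub_pos.2 hβ1) (continuousOn_deriv_of_contDiffAt hf)
          hright]
    _ = -∫ x in a..b, deriv f x * (g x - g b) := by
        congr 1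
        refine intervalIntegral.integral_congr fun x hx => ?_
        rw [uIcc_of_le hab] at hx
        simp only [rightFracIntegral_rightFracDeriv hg (sub_pos.2 hβ1) (by linarith) hα hx]
    _ = ∫ x in a..b, deriv f x * (g b - g x) := by
        simp only [← intervalIntegral.integral_neg, ← mul_neg, neg_sub]

section SmoothStep

/-- A smooth monotone function rising from `0` to `1` on `[r, r + θ]`. -/
noncomputable def smoothStep (r θ t : ℝ) : ℝ := Real.smoothTransition ((t - r) / θ)

variable {r θ t : ℝ}

theorem contDiff_smoothStep (r θ : ℝ) : ContDiff ℝ 1 (smoothStep r θ) :=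
  Real.smoothTransition.contDiff.comp ((contDiff_id.sub contDiff_const).div_const θ)

theorem monotone_smoothStep (r : ℝ) (hθ : 0 ≤ θ) : Monotone (smoothStep r θ) := fun _ _ h =>
  Real.smoothTransition.monotone (div_le_div_of_nonneg_right (sub_le_sub_right h r) hθ)

theorem smoothStep_eq_zero (hθ : 0 ≤ θ) (h : t ≤ r) : smoothStep r θ t = 0 :=
  Real.smoothTransition.zero_of_nonpos (div_nonpos_of_nonpos_of_nonneg (sub_nonpos.2 h) hθ)

theorem smoothStep_eq_one (hθ : 0 < θ) (h : r + θ ≤ t) : smoothStep r θ t = 1 :=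
  Real.smoothTransition.one_of_one_le ((one_le_div hθ).2 (le_sub_iff_add_le'.2 h))

theorem deriv_smoothStep_nonneg (hθ : 0 ≤ θ) (t : ℝ) : 0 ≤ deriv (smoothStep r θ) t :=
  (monotone_smoothStep r hθ).deriv_nonneg

theorem deriv_smoothStep_eq_zero (hθ : 0 < θ) (h : t ∉ Icc r (r + θ)) :
    deriv (smoothStep r θ) t = 0 := by
  rw [mem_Icc, not_and_or, not_le, not_le] at h
  rcases h with h | h
  · have heq : smoothStep r θ =ᶠ[𝓝 t] fun _ => 0 := by
      filter_upwards [Iio_mem_nhds h] with u hu using smoothStep_eq_zero hθ.le (le_of_lt hu)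
    rw [heq.deriv_eq, deriv_const]
  · have heq : smoothStep r θ =ᶠ[𝓝 t] fun _ => 1 := by
      filter_upwards [Ioi_mem_nhds h] with u hu using smoothStep_eq_one hθ (le_of_lt hu)
    rw [heq.deriv_eq, deriv_const]

theorem intervalIntegrable_deriv_mul {f g : ℝ → ℝ} {a b : ℝ} (hf : ContDiff ℝ 1 f)
    (hg : ContinuousOn g (uIcc a b)) :
    IntervalIntegrable (fun u => deriv f u * g u) volume a b :=
  ((hf.continuous_deriv le_rfl).continuousOn.mul hg).intervalIntegrable

theorem integral_deriv_smoothStep {a : ℝ} (hθ : 0 ≤ θ) (har : a ≤ r) (t : ℝ) :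
    ∫ u in a..t, deriv (smoothStep r θ) u = smoothStep r θ t := by
  have hS := contDiff_smoothStep r θ
  rw [intervalIntegral.integral_deriv_eq_sub
    (fun u _ => hS.differentiable one_ne_zero u)
    ((hS.continuous_deriv le_rfl).intervalIntegrable _ _), smoothStep_eq_zero hθ har, sub_zero]

theorem abs_integral_deriv_smoothStep_mul_le {g : ℝ → ℝ} {a D : ℝ} (hθ : 0 < θ) (har : a ≤ r)
    (hat : a ≤ t) (hg : ∀ u ∈ Icc a t, u ∈ Icc r (r + θ) → |g u| ≤ D) :
    |∫ u in a..t, deriv (smoothStep r θ) u * g u| ≤ smoothStep r θ t * D := by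
  have hS := (contDiff_smoothStep r θ).continuous_deriv le_rfl
  rw [← integral_deriv_smoothStep hθ.le har, ← intervalIntegral.integral_mul_const,
    ← Real.norm_eq_abs]
  refine intervalIntegral.norm_integral_le_of_norm_le (μ := volume) hat (ae_of_all _ fun u hu => ?_)
    ((hS.mul continuous_const).intervalIntegrable _ _)
  rw [norm_mul, Real.norm_of_nonneg (deriv_smoothStep_nonneg hθ.le u)]
  by_cases hur : u ∈ Icc r (r + θ)
  · exact mul_le_mul_of_nonneg_left (hg u (Ioc_subset_Icc_self hu) hur)
      (deriv_smoothStep_nonneg hθ.le u)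
  · rw [deriv_smoothStep_eq_zero hθ hur, zero_mul, zero_mul]

theorem abs_integral_deriv_smoothStep_mul_sub_sub_le {g : ℝ → ℝ} {a D : ℝ} (hθ : 0 < θ)
    (har : a ≤ r) (hat : a ≤ t) (hg : ContinuousOn g (Icc a t))
    (hD : ∀ u ∈ Icc a t, ∀ v ∈ Icc a t, |u - v| ≤ θ → |g u - g v| ≤ D) :
    |(∫ u in a..t, deriv (smoothStep r θ) u * (g t - g u)) - (g t - g (min r t))| ≤ D := by
  have hg' : ContinuousOn g (uIcc a t) := by rwa [uIcc_of_le hat]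
  have hsplit : (∫ u in a..t, deriv (smoothStep r θ) u * (g t - g u)) =
      (∫ u in a..t, deriv (smoothStep r θ) u * (g (min r t) - g u)) +
        smoothStep r θ t * (g t - g (min r t)) := by
    rw [← integral_deriv_smoothStep hθ.le har, ← intervalIntegral.integral_mul_const,
      ← intervalIntegral.integral_add]
    · exact intervalIntegral.integral_congr fun u _ => by ring
    · exact intervalIntegrable_deriv_mul (contDiff_smoothStep r θ) (continuousOn_const.sub hg')
    · exact intervalIntegrable_deriv_mul (contDiff_smoothStep r θ) continuousOn_const
  have hmin : min r t ∈ Icc a t := ⟨le_min har hat, min_le_right _ _⟩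
  have hbefore : |∫ u in a..t, deriv (smoothStep r θ) u * (g (min r t) - g u)| ≤
      smoothStep r θ t * D :=
    abs_integral_deriv_smoothStep_mul_le hθ har hat fun u hu hur => hD _ hmin u hu <| by
      rw [min_eq_left (hur.1.trans hu.2), abs_le]
      constructor <;> linarith [hur.1, hur.2]
  have hafter : |(smoothStep r θ t - 1) * (g t - g (min r t))| ≤ (1 - smoothStep r θ t) * D := by
    have hle : smoothStep r θ t ≤ 1 := Real.smoothTransition.le_one _
    rw [abs_mul, abs_of_nonpos (sub_nonpos.2 hle), neg_sub]
    rcases le_total (r + θ) t with h | h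
    · simp only [smoothStep_eq_one hθ h, sub_self, zero_mul, le_refl]
    · refine mul_le_mul_of_nonneg_left (hD t (right_mem_Icc.2 hat) _ hmin ?_) (sub_nonneg.2 hle)
      rw [abs_of_nonneg (sub_nonneg.2 (min_le_right _ _)), sub_le_comm]
      exact le_min (by linarith) (by linarith)
  calc _ = |(∫ u in a..t, deriv (smoothStep r θ) u * (g (min r t) - g u)) +
        (smoothStep r θ t - 1) * (g t - g (min r t))| := by
        rw [hsplit]
        congr 1
        ring
    _ ≤ smoothStep r θ t * D + (1 - smoothStep r θ t) * D :=
      (abs_add_le _ _).trans (add_le_add hbefore hafter)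
    _ = D := by ring

end SmoothStep

section SmoothedSimple

variable {c s : ℕ → ℝ} {θ t : ℝ} {N : ℕ}

/-- The simple function `∑ k < N, c k • 1_[s k, s (k + 1))` with each jump spread smoothly over
time `θ`. -/
noncomputable def smoothedSimple (c s : ℕ → ℝ) (θ : ℝ) (N : ℕ) (t : ℝ) : ℝ :=
  ∑ k ∈ Finset.range N, c k * (smoothStep (s k) θ t - smoothStep (s (k + 1)) θ t)

theorem contDiff_smoothedSimple (c s : ℕ → ℝ) (θ : ℝ) (N : ℕ) :
    ContDiff ℝ 1 (smoothedSimple c s θ N) :=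
  ContDiff.sum fun _ _ =>
    contDiff_const.mul ((contDiff_smoothStep _ θ).sub (contDiff_smoothStep _ θ))

theorem smoothedSimple_eq_zero (hs : Monotone s) (hθ : 0 ≤ θ) (ht : t ≤ s 0) :
    smoothedSimple c s θ N t = 0 :=
  Finset.sum_eq_zero fun k _ => by
    rw [smoothStep_eq_zero hθ (ht.trans (hs k.zero_le)),
      smoothStep_eq_zero hθ (ht.trans (hs (k + 1).zero_le)), sub_zero, mul_zero]

theorem deriv_smoothedSimple (c s : ℕ → ℝ) (θ : ℝ) (N : ℕ) (t : ℝ) :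
    deriv (smoothedSimple c s θ N) t = ∑ k ∈ Finset.range N,
      c k * (deriv (smoothStep (s k) θ) t - deriv (smoothStep (s (k + 1)) θ) t) := by
  have hS : ∀ r, HasDerivAt (smoothStep r θ) (deriv (smoothStep r θ) t) t := fun r =>
    ((contDiff_smoothStep r θ).differentiable one_ne_zero t).hasDerivAt
  exact (HasDerivAt.fun_sum fun k _ => ((hS _).sub (hS _)).const_mul (c k)).deriv

theorem abs_integral_deriv_smoothedSimple_mul_sub_sub_le {g : ℝ → ℝ} {a B D : ℝ} (hs : Monotone s)
    (hθ : 0 < θ) (has : a ≤ s 0) (hat : a ≤ t) (hg : ContinuousOn g (Icc a t))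
    (hD : ∀ u ∈ Icc a t, ∀ v ∈ Icc a t, |u - v| ≤ θ → |g u - g v| ≤ D) (hc : ∀ k, |c k| ≤ B) :
    |(∫ u in a..t, deriv (smoothedSimple c s θ N) u * (g t - g u)) -
      ∑ k ∈ Finset.range N, c k * (g (min (s (k + 1)) t) - g (min (s k) t))| ≤
        N * (B * (2 * D)) := by
  set I : ℕ → ℝ := fun k => ∫ u in a..t, deriv (smoothStep (s k) θ) u * (g t - g u)
  have hint : ∀ k, IntervalIntegrable (fun u => deriv (smoothStep (s k) θ) u * (g t - g u))
      volume a t := fun k =>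
    intervalIntegrable_deriv_mul (contDiff_smoothStep _ _) <| by
      rw [uIcc_of_le hat]
      exact continuousOn_const.sub hg
  have hI : ∀ k, |I k - (g t - g (min (s k) t))| ≤ D := fun k =>
    abs_integral_deriv_smoothStep_mul_sub_sub_le hθ (has.trans (hs k.zero_le)) hat hg hD
  have hsum : (∫ u in a..t, deriv (smoothedSimple c s θ N) u * (g t - g u)) =
      ∑ k ∈ Finset.range N, c k * (I k - I (k + 1)) := by
    simp only [deriv_smoothedSimple, Finset.sum_mul, mul_assoc, sub_mul]
    rw [intervalIntegral.integral_finsetSum fun k _ => ((hint k).sub (hint (k + 1))).const_mul _]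
    refine Finset.sum_congr rfl fun k _ => ?_
    rw [intervalIntegral.integral_const_mul, intervalIntegral.integral_sub (hint k) (hint (k + 1))]
  rw [hsum, ← Finset.sum_sub_distrib]
  refine (Finset.abs_sum_le_sum_abs _ _).trans
    ((Finset.sum_le_card_nsmul _ _ (B * (2 * D)) fun k _ => ?_).trans_eq
      (by rw [Finset.card_range, nsmul_eq_mul]))
  rw [← mul_sub, abs_mul]
  refine mul_le_mul (hc k) ?_ (abs_nonneg _) ((abs_nonneg _).trans (hc k))
  calc _ = |(I k - (g t - g (min (s k) t))) - (I (k + 1) - (g t - g (min (s (k + 1)) t)))| := by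
        ring_nf
    _ ≤ D + D := (abs_sub _ _).trans (add_le_add (hI k) (hI (k + 1)))
    _ = 2 * D := (two_mul D).symm

end SmoothedSimple

section StoppedPosition

variable {y z : ℕ → ℝ} {ε D : ℝ} {k n : ℕ}

/-- The position held after observing `y 0, …, y k`: proportional to `y k - y 0` until the first
time `|y j - y 0|` reaches the level `ε`, and zero afterwards. -/
noncomputable def stoppedPosition (y : ℕ → ℝ) (ε : ℝ) (k : ℕ) : ℝ :=
  open Classical in if ∀ j ≤ k, |y j - y 0| < ε then 2 / ε ^ 2 * (y k - y 0) else 0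

/-- The potential `((y n - y 0) / ε) ^ 2` of the position `stoppedPosition y ε`, frozen at the
value `1` once `|y j - y 0|` has reached the level `ε`. -/
noncomputable def stoppedSquare (y : ℕ → ℝ) (ε : ℝ) (n : ℕ) : ℝ :=
  open Classical in if ∀ j ≤ n, |y j - y 0| < ε then ((y n - y 0) / ε) ^ 2 else 1

theorem abs_stoppedPosition_le (y : ℕ → ℝ) (hε : 0 < ε) (k : ℕ) :
    |stoppedPosition y ε k| ≤ 2 / ε := by
  unfold stoppedPosition
  split_ifs with h
  · rw [abs_mul, abs_of_pos (by positivity)]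
    calc 2 / ε ^ 2 * |y k - y 0| ≤ 2 / ε ^ 2 * ε := by gcongr; exact (h k le_rfl).le
      _ = 2 / ε := by field_simp
  · rw [abs_zero]
    positivity

theorem stoppedPosition_congr (ε : ℝ) (h : ∀ j ≤ k, y j = z j) :
    stoppedPosition y ε k = stoppedPosition z ε k := by
  have hiff : (∀ j ≤ k, |y j - z 0| < ε) ↔ ∀ j ≤ k, |z j - z 0| < ε :=
    forall₂_congr fun j hj => by rw [h j hj]
  simp only [stoppedPosition, h k le_rfl, h 0 k.zero_le, hiff]

theorem measurable_stoppedPosition {Ω : Type*} [MeasurableSpace Ω] {y : ℕ → Ω → ℝ} (ε : ℝ)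
    (hy : ∀ j ≤ k, Measurable (y j)) :
    Measurable fun ω => stoppedPosition (fun j => y j ω) ε k := by
  have h0 := hy 0 k.zero_le
  have hset : MeasurableSet {ω | ∀ j ≤ k, |y j ω - y 0 ω| < ε} := by
    simp only [ofPred_forall]
    exact MeasurableSet.iInter fun j => MeasurableSet.iInter fun hj =>
      measurableSet_lt ((hy j hj).sub h0).abs measurable_const
  exact Measurable.ite hset (((hy k le_rfl).sub h0).const_mul _) measurable_const

theorem stoppedSquare_nonneg (y : ℕ → ℝ) (ε : ℝ) (n : ℕ) : 0 ≤ stoppedSquare y ε n := by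
  unfold stoppedSquare
  split_ifs <;> positivity

theorem stoppedSquare_eq_one (hk : k ≤ n) (h : ε ≤ |y k - y 0|) : stoppedSquare y ε n = 1 :=
  if_neg fun hlt => (hlt k hk).not_ge h

theorem stoppedSquare_zero (y : ℕ → ℝ) (hε : 0 < ε) : stoppedSquare y ε 0 = 0 := by
  simp [stoppedSquare, hε]

theorem stoppedSquare_succ_sub_le (y : ℕ → ℝ) (hε : 0 < ε) (n : ℕ) :
    stoppedSquare y ε (n + 1) - stoppedSquare y ε n ≤
      stoppedPosition y ε n * (y (n + 1) - y n) + ((y (n + 1) - y n) / ε) ^ 2 := by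
  by_cases hn : ∀ j ≤ n, |y j - y 0| < ε
  · have hsucc : stoppedSquare y ε (n + 1) ≤ ((y (n + 1) - y 0) / ε) ^ 2 := by
      unfold stoppedSquare
      split_ifs with h
      · exact le_rfl
      · have hexit : ε ≤ |y (n + 1) - y 0| := by
          by_contra! hlt
          exact h fun j hj => (Nat.le_succ_iff.1 hj).elim (hn j) fun hj => hj ▸ hlt
        rwa [one_le_sq_iff_one_le_abs, abs_div, abs_of_pos hε, one_le_div hε]
    calc _ ≤ ((y (n + 1) - y 0) / ε) ^ 2 - ((y n - y 0) / ε) ^ 2 := by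
          rw [stoppedSquare.eq_def y ε n, if_pos hn]
          exact sub_le_sub_right hsucc _
      _ = 2 / ε ^ 2 * (y n - y 0) * (y (n + 1) - y n) + ((y (n + 1) - y n) / ε) ^ 2 := by ring
      _ = _ := by rw [stoppedPosition, if_pos hn]
  · have hn' : ¬ ∀ j ≤ n + 1, |y j - y 0| < ε := fun h => hn fun j hj => h j (hj.trans n.le_succ)
    rw [stoppedSquare, stoppedSquare, stoppedPosition, if_neg hn, if_neg hn', if_neg hn, sub_self,
      zero_mul, zero_add]
    positivity

theorem stoppedSquare_sub_le_sum_stoppedPosition (hε : 0 < ε) (n : ℕ)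
    (hD : ∀ k < n, |y (k + 1) - y k| ≤ D) :
    stoppedSquare y ε n - n * (D / ε) ^ 2 ≤
      ∑ k ∈ Finset.range n, stoppedPosition y ε k * (y (k + 1) - y k) := by
  have hquad : ∀ k ∈ Finset.range n, ((y (k + 1) - y k) / ε) ^ 2 ≤ (D / ε) ^ 2 := fun k hk => by
    rw [div_pow, div_pow, ← sq_abs (y (k + 1) - y k)]
    gcongr
    exact hD k (Finset.mem_range.1 hk)
  have htelescope := Finset.sum_range_sub (stoppedSquare y ε) n
  rw [stoppedSquare_zero y hε, sub_zero] at htelescope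
  rw [← htelescope, sub_le_iff_le_add]
  calc _ ≤ ∑ k ∈ Finset.range n,
        (stoppedPosition y ε k * (y (k + 1) - y k) + (D / ε) ^ 2) :=
        Finset.sum_le_sum fun k hk => (stoppedSquare_succ_sub_le y hε k).trans
          (add_le_add_right (hquad k hk) _)
    _ = _ := by rw [Finset.sum_add_distrib, Finset.sum_const, Finset.card_range, nsmul_eq_mul]

end StoppedPosition

section GridSequence

/-- Consecutive intervals `[τ n, τ (n + 1)]` exhausting `[τ 0, 1)`, each with an equidistant grid of
`N n` steps, an exit level `ε n` and a switching time `θ n`. The last two fields make the grids fine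
enough for `α`-Hölder paths: the `n`-th block of the strategy loses at most a multiple of
`(1 / 2) ^ n` to the quadratic variation along the grid and to the smooth switching. -/
structure GridSequence (α : ℝ) where
  τ : ℕ → ℝ
  N : ℕ → ℕ
  ε : ℕ → ℝ
  θ : ℕ → ℝ
  zero_le_τ_zero : 0 ≤ τ 0
  strictMono_τ : StrictMono τ
  tendsto_τ : Tendsto τ atTop (𝓝 1)
  N_pos : ∀ n, 0 < N n
  ε_pos : ∀ n, 0 < ε n
  θ_pos : ∀ n, 0 < θ n
  mesh_sq_le : ∀ n, N n * (((τ (n + 1) - τ n) / N n) ^ α / ε n) ^ 2 ≤ (1 / 2) ^ n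
  switch_le : ∀ n, N n * (4 / ε n) * θ n ^ α ≤ (1 / 2) ^ n

theorem exists_nat_mul_div_rpow_sq_le {α Δ ε η : ℝ} (hα : 1 / 2 < α) (hΔ : 0 ≤ Δ) (hη : 0 < η) :
    ∃ N : ℕ, 0 < N ∧ N * ((Δ / N) ^ α / ε) ^ 2 ≤ η := by
  have hlim : Tendsto (fun N : ℕ => N * ((Δ / N) ^ α / ε) ^ 2) atTop (𝓝 0) := by
    have hpow := ((tendsto_rpow_neg_atTop (y := 2 * α - 1) (by linarith)).comp
      (tendsto_natCast_atTop_atTop (R := ℝ))).const_mul ((Δ ^ α / ε) ^ 2)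
    rw [mul_zero] at hpow
    refine hpow.congr' ?_
    filter_upwards [eventually_gt_atTop 0] with N hN
    have hN' : (0 : ℝ) < N := Nat.cast_pos.2 hN
    have hsq : (N : ℝ) ^ (2 * α) = ((N : ℝ) ^ α) ^ 2 := by
      rw [mul_comm, Real.rpow_mul hN'.le, Real.rpow_two]
    rw [Function.comp_apply, neg_sub, Real.rpow_sub hN', Real.rpow_one, hsq,
      Real.div_rpow hΔ hN'.le]
    ring
  exact ((eventually_gt_atTop 0).and (hlim.eventually_le_const hη)).exists

theorem exists_pos_mul_rpow_le {α K η : ℝ} (hα : 0 < α) (hη : 0 < η) :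
    ∃ θ : ℝ, 0 < θ ∧ K * θ ^ α ≤ η := by
  have hcont : Continuous fun θ : ℝ => K * θ ^ α :=
    continuous_const.mul (continuous_id.rpow_const fun _ => Or.inr hα.le)
  have hlim : Tendsto (fun θ : ℝ => K * θ ^ α) (𝓝[>] 0) (𝓝 0) := by
    simpa [Real.zero_rpow hα.ne'] using (hcont.tendsto 0).mono_left nhdsWithin_le_nhds
  exact (eventually_mem_nhdsWithin.and (hlim.eventually_le_const hη)).exists

theorem exists_gridSequence {α : ℝ} (hα : 1 / 2 < α) {τ ε : ℕ → ℝ} (h0 : 0 ≤ τ 0)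
    (hτ : StrictMono τ) (hlim : Tendsto τ atTop (𝓝 1)) (hε : ∀ n, 0 < ε n) :
    ∃ G : GridSequence α, G.τ = τ ∧ G.ε = ε := by
  have hη : ∀ n : ℕ, (0 : ℝ) < (1 / 2) ^ n := fun n => by positivity
  choose N hN hmesh using fun n => exists_nat_mul_div_rpow_sq_le (ε := ε n) hα
    (sub_nonneg.2 (hτ n.lt_succ_self).le) (hη n)
  choose θ hθ hswitch using fun n =>
    exists_pos_mul_rpow_le (K := N n * (4 / ε n)) (one_half_pos.trans hα) (hη n)
  exact ⟨⟨τ, N, ε, θ, h0, hτ, hlim, hN, hε, hθ, hmesh, hswitch⟩, rfl, rfl⟩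

namespace GridSequence

variable {α : ℝ} (G : GridSequence α)

/-- The step of the `n`-th grid. -/
noncomputable def mesh (n : ℕ) : ℝ := (G.τ (n + 1) - G.τ n) / G.N n

/-- The `k`-th point of the `n`-th grid. -/
noncomputable def point (n k : ℕ) : ℝ := G.τ n + k * G.mesh n

/-- The trading strategy in the path `x` on the `n`-th interval: the stopped quadratic strategy
along the grid, with smoothed jumps. -/
noncomputable def block (x : ℝ → ℝ) (n : ℕ) : ℝ → ℝ :=
  smoothedSimple (stoppedPosition (fun k => x (G.point n k)) (G.ε n)) (G.point n) (G.θ n) (G.N n)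

/-- The trading strategy in the path `x` on `[0, 1)`; the sum is locally finite there. -/
noncomputable def strategy (x : ℝ → ℝ) (t : ℝ) : ℝ := ∑' n, G.block x n t

theorem τ_nonneg (n : ℕ) : 0 ≤ G.τ n :=
  G.zero_le_τ_zero.trans (G.strictMono_τ.monotone n.zero_le)

theorem τ_lt_one (n : ℕ) : G.τ n < 1 :=
  (G.strictMono_τ n.lt_succ_self).trans_le (G.strictMono_τ.monotone.ge_of_tendsto G.tendsto_τ _)

theorem exists_lt_τ {t : ℝ} (ht : t < 1) : ∃ M, t < G.τ M :=
  (G.tendsto_τ.eventually (lt_mem_nhds ht)).exists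

theorem mesh_pos (n : ℕ) : 0 < G.mesh n :=
  div_pos (sub_pos.2 (G.strictMono_τ n.lt_succ_self)) (Nat.cast_pos.2 (G.N_pos n))

theorem point_zero (n : ℕ) : G.point n 0 = G.τ n := by simp [point]

theorem point_succ (n k : ℕ) : G.point n (k + 1) = G.point n k + G.mesh n := by
  simp only [point, Nat.cast_succ]
  ring

theorem N_mul_mesh (n : ℕ) : G.N n * G.mesh n = G.τ (n + 1) - G.τ n :=
  mul_div_cancel₀ _ (Nat.cast_pos.2 (G.N_pos n)).ne'

theorem point_N (n : ℕ) : G.point n (G.N n) = G.τ (n + 1) := by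
  rw [point, N_mul_mesh, add_sub_cancel]

theorem monotone_point (n : ℕ) : Monotone (G.point n) :=
  monotone_nat_of_le_succ fun k => by
    rw [point_succ]
    exact le_add_of_nonneg_right (G.mesh_pos n).le

theorem point_nonneg (n k : ℕ) : 0 ≤ G.point n k :=
  (G.τ_nonneg n).trans ((G.point_zero n).symm.trans_le (G.monotone_point n k.zero_le))

theorem exists_abs_sub_point_le {n : ℕ} {u : ℝ} (hu : u ∈ Icc (G.τ n) (G.τ (n + 1))) :
    ∃ k ≤ G.N n, |u - G.point n k| ≤ G.mesh n := by
  have hm := G.mesh_pos n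
  have hfloor := Nat.floor_le (div_nonneg (sub_nonneg.2 hu.1) hm.le)
  have hlt := Nat.lt_floor_add_one ((u - G.τ n) / G.mesh n)
  rw [le_div_iff₀ hm] at hfloor
  rw [div_lt_iff₀ hm] at hlt
  refine ⟨⌊(u - G.τ n) / G.mesh n⌋₊, Nat.floor_le_of_le ?_, ?_⟩
  · rw [div_le_iff₀ hm, N_mul_mesh]
    exact sub_le_sub_right hu.2 _
  · rw [point, abs_le]
    constructor <;> linarith

theorem contDiff_block (x : ℝ → ℝ) (n : ℕ) : ContDiff ℝ 1 (G.block x n) :=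
  contDiff_smoothedSimple _ _ _ _

theorem strategy_eq_sum (x : ℝ → ℝ) {t : ℝ} {M : ℕ} (ht : t ≤ G.τ M) :
    G.strategy x t = ∑ n ∈ Finset.range M, G.block x n t := by
  refine tsum_eq_sum fun n hn => smoothedSimple_eq_zero (G.monotone_point n) (G.θ_pos n).le ?_
  rw [Finset.mem_range, not_lt] at hn
  rw [point_zero]
  exact ht.trans (G.strictMono_τ.monotone hn)

theorem strategy_zero (x : ℝ → ℝ) : G.strategy x 0 = 0 := by
  rw [G.strategy_eq_sum x G.zero_le_τ_zero, Finset.sum_range_zero]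

theorem strategy_eventuallyEq_sum (x : ℝ → ℝ) {t : ℝ} {M : ℕ} (ht : t < G.τ M) :
    G.strategy x =ᶠ[𝓝 t] fun u => ∑ n ∈ Finset.range M, G.block x n u := by
  filter_upwards [Iio_mem_nhds ht] with u hu using G.strategy_eq_sum x (le_of_lt hu)

theorem contDiffAt_strategy (x : ℝ → ℝ) {t : ℝ} (ht : t < 1) :
    ContDiffAt ℝ 1 (G.strategy x) t := by
  obtain ⟨M, hM⟩ := G.exists_lt_τ ht
  exact (ContDiff.sum fun n _ => G.contDiff_block x n).contDiffAt.congr_of_eventuallyEq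
    (G.strategy_eventuallyEq_sum x hM)

theorem deriv_strategy (x : ℝ → ℝ) {t : ℝ} {M : ℕ} (ht : t < G.τ M) :
    deriv (G.strategy x) t = ∑ n ∈ Finset.range M, deriv (G.block x n) t := by
  rw [(G.strategy_eventuallyEq_sum x ht).deriv_eq, deriv_fun_sum fun n _ =>
    (G.contDiff_block x n).differentiable one_ne_zero t]

theorem measurable_strategy {Ω : Type*} [MeasurableSpace Ω] {X : ℝ → Ω → ℝ} {t : ℝ} (ht : t < 1)
    (hX : ∀ s ∈ Icc 0 t, Measurable (X s)) : Measurable fun ω => G.strategy (fun s => X s ω) t := by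
  obtain ⟨M, hM⟩ := G.exists_lt_τ ht
  simp only [G.strategy_eq_sum _ hM.le, block, smoothedSimple]
  refine Finset.measurable_fun_sum _ fun n _ => Finset.measurable_fun_sum _ fun k _ => ?_
  rcases le_total (G.point n k) t with h | h
  · exact (measurable_stoppedPosition _ fun j hj =>
      hX _ ⟨G.point_nonneg n j, (G.monotone_point n hj).trans h⟩).mul_const _
  · have hθ := (G.θ_pos n).le
    simp only [smoothStep_eq_zero hθ h,
      smoothStep_eq_zero hθ (h.trans (G.monotone_point n k.le_succ)), sub_zero, mul_zero,
      measurable_const]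

end GridSequence

end GridSequence

section Divergence

variable {g : ℝ → ℝ} {C α : ℝ≥0} {β t : ℝ}

theorem abs_sub_le_rpow_of_holderOnWith {a b x u d : ℝ} (hg : HolderOnWith C α g (Icc a b))
    (hx : x ∈ Icc a b) (hu : u ∈ Icc a b) (h : |x - u| ≤ d) : |g x - g u| ≤ C * d ^ (α : ℝ) :=
  (abs_sub_le_of_holderOnWith hg hx hu).trans (by gcongr)

theorem stoppedPosition_mul_sub_min {s : ℕ → ℝ} (hs : Monotone s) (g : ℝ → ℝ) (ε t : ℝ) (k : ℕ) :
    stoppedPosition (fun j => g (s j)) ε k * (g (min (s (k + 1)) t) - g (min (s k) t)) =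
      stoppedPosition (fun j => g (min (s j) t)) ε k *
        (g (min (s (k + 1)) t) - g (min (s k) t)) := by
  rcases le_total (s k) t with h | h
  · rw [stoppedPosition_congr (z := fun j => g (min (s j) t)) ε fun j hj => ?_]
    rw [min_eq_left ((hs hj).trans h)]
  · rw [min_eq_right h, min_eq_right (h.trans (hs k.le_succ)), sub_self, mul_zero, mul_zero]

namespace GridSequence

variable (G : GridSequence α)

theorem glsIntegrable_strategy (hg : HolderOnWith C α g (Icc 0 t)) (hβ : 0 < β) (hβ1 : β < 1)
    (hα : 1 - β < α) (ht : t ∈ Ico 0 1) : GLSIntegrable β (G.strategy g) g 0 t := by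
  obtain ⟨K, hK⟩ := exists_holderOnWith_one_of_contDiffAt fun u (hu : u ∈ Icc 0 t) =>
    G.contDiffAt_strategy g (hu.2.trans_lt ht.2)
  exact glsIntegrable_of_holderOnWith hK hg hβ hβ1 (by exact_mod_cast hβ1) hα ht.1
    (G.strategy_zero g)

theorem glsIntegral_strategy {M : ℕ} (hg : HolderOnWith C α g (Icc 0 t)) (hβ : 0 < β)
    (hβ1 : β < 1) (hα : 1 - β < α) (ht : t ∈ Ico 0 1) (hM : t < G.τ M) :
    glsIntegral β (G.strategy g) g 0 t =
      ∑ n ∈ Finset.range M, ∫ u in 0..t, deriv (G.block g n) u * (g t - g u) := by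
  have hcont : ContinuousOn g (Icc 0 t) :=
    hg.continuousOn (by exact_mod_cast (sub_pos.2 hβ1).trans hα)
  rw [glsIntegral_eq_integral_deriv_mul ht.1
    (fun u hu => G.contDiffAt_strategy g (hu.2.trans_lt ht.2)) (G.strategy_zero g) hg hβ hβ1 hα,
    ← intervalIntegral.integral_finsetSum fun n _ => intervalIntegrable_deriv_mul
      (G.contDiff_block g n) (by rw [uIcc_of_le ht.1]; exact continuousOn_const.sub hcont)]
  refine intervalIntegral.integral_congr fun u hu => ?_
  rw [uIcc_of_le ht.1] at hu
  simp only [G.deriv_strategy g (hu.2.trans_lt hM), Finset.sum_mul]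

theorem stoppedSquare_sub_le_integral_deriv_block (hα : 0 < α) (hg : HolderOnWith C α g (Icc 0 t))
    (ht : 0 ≤ t) (n : ℕ) :
    stoppedSquare (fun k => g (min (G.point n k) t)) (G.ε n) (G.N n) - (C ^ 2 + C) * (1 / 2) ^ n ≤
      ∫ u in 0..t, deriv (G.block g n) u * (g t - g u) := by
  have hsmooth := abs_integral_deriv_smoothedSimple_mul_sub_sub_le (N := G.N n)
    (G.monotone_point n) (G.θ_pos n) (G.point_nonneg n 0) ht (hg.continuousOn hα)
    (fun _ hu _ hv => abs_sub_le_rpow_of_holderOnWith hg hu hv)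
    (abs_stoppedPosition_le (fun k => g (G.point n k)) (G.ε_pos n))
  simp only [stoppedPosition_mul_sub_min (G.monotone_point n)] at hsmooth
  have hmem : ∀ k, min (G.point n k) t ∈ Icc 0 t := fun k =>
    ⟨le_min (G.point_nonneg n k) ht, min_le_right _ _⟩
  have hincr : ∀ k, |min (G.point n (k + 1)) t - min (G.point n k) t| ≤ G.mesh n := fun k => by
    simpa [point_succ, abs_of_pos (G.mesh_pos n), (G.mesh_pos n).le] using
      abs_min_sub_min_le_max (G.point n (k + 1)) t (G.point n k) t
  have hdiscrete := stoppedSquare_sub_le_sum_stoppedPosition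
    (y := fun k => g (min (G.point n k) t)) (G.ε_pos n) (G.N n) fun k _ =>
      abs_sub_le_rpow_of_holderOnWith hg (hmem (k + 1)) (hmem k) (hincr k)
  have hmesh : G.N n * (C * G.mesh n ^ (α : ℝ) / G.ε n) ^ 2 ≤ C ^ 2 * (1 / 2) ^ n := calc
    _ = C ^ 2 * (G.N n * (G.mesh n ^ (α : ℝ) / G.ε n) ^ 2) := by ring
    _ ≤ _ := mul_le_mul_of_nonneg_left (G.mesh_sq_le n) (sq_nonneg _)
  have hswitch : G.N n * (2 / G.ε n * (2 * (C * G.θ n ^ (α : ℝ)))) ≤ C * (1 / 2) ^ n := calc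
    _ = C * (G.N n * (4 / G.ε n) * G.θ n ^ (α : ℝ)) := by ring
    _ ≤ _ := mul_le_mul_of_nonneg_left (G.switch_le n) C.coe_nonneg
  have hlower := (abs_le.1 hsmooth).1
  rw [block]
  linarith

theorem abs_sub_le_ε_of_abs_sub_le_mesh {u v : ℝ} {n : ℕ} (hg : HolderOnWith C α g (Icc 0 1))
    (hn : C ^ 2 * (1 / 2 : ℝ) ^ n ≤ 1) (hu : u ∈ Icc (0 : ℝ) 1) (hv : v ∈ Icc (0 : ℝ) 1)
    (huv : |u - v| ≤ G.mesh n) : |g u - g v| ≤ G.ε n := by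
  have hN : (1 : ℝ) ≤ G.N n := Nat.one_le_cast.2 (G.N_pos n)
  have hsq : (C * G.mesh n ^ (α : ℝ) / G.ε n) ^ 2 ≤ 1 := calc
    _ = C ^ 2 * (1 * (G.mesh n ^ (α : ℝ) / G.ε n) ^ 2) := by ring
    _ ≤ C ^ 2 * (G.N n * (G.mesh n ^ (α : ℝ) / G.ε n) ^ 2) := by gcongr
    _ ≤ C ^ 2 * (1 / 2) ^ n := mul_le_mul_of_nonneg_left (G.mesh_sq_le n) (sq_nonneg _)
    _ ≤ 1 := hn
  refine (abs_sub_le_rpow_of_holderOnWith hg hu hv huv).trans ?_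
  exact (div_le_one (G.ε_pos n)).1 (le_of_abs_le ((sq_le_one_iff_abs_le_one _).1 hsq))

theorem stoppedSquare_eq_one_of_exists_lt {n : ℕ} (hg : HolderOnWith C α g (Icc 0 1))
    (hn : C ^ 2 * (1 / 2 : ℝ) ^ n ≤ 1) (hnt : G.τ (n + 1) ≤ t)
    (hexit : ∃ u ∈ Icc (G.τ n) (G.τ (n + 1)), 2 * G.ε n < |g u - g (G.τ n)|) :
    stoppedSquare (fun k => g (min (G.point n k) t)) (G.ε n) (G.N n) = 1 := by
  obtain ⟨u, hu, hlt⟩ := hexit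
  obtain ⟨k, hk, hdist⟩ := G.exists_abs_sub_point_le hu
  have hle : ∀ j ≤ G.N n, G.point n j ≤ G.τ (n + 1) := fun j hj =>
    (G.monotone_point n hj).trans_eq (G.point_N n)
  have hclose : |g u - g (G.point n k)| ≤ G.ε n := G.abs_sub_le_ε_of_abs_sub_le_mesh hg hn
    ⟨(G.τ_nonneg n).trans hu.1, hu.2.trans (G.τ_lt_one _).le⟩
    ⟨G.point_nonneg n k, (hle k hk).trans (G.τ_lt_one _).le⟩ hdist
  refine stoppedSquare_eq_one hk ?_
  rw [min_eq_left ((hle k hk).trans hnt), min_eq_left ((hle 0 (Nat.zero_le _)).trans hnt),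
    point_zero]
  linarith [abs_sub_le (g u) (g (G.point n k)) (g (G.τ n))]

end GridSequence

theorem card_sub_le_sum_range {I : ℕ → ℝ} {κ : ℝ} {F : Finset ℕ} {M : ℕ} (hκ : 0 ≤ κ)
    (hI : ∀ n, -(κ * (1 / 2) ^ n) ≤ I n) (hIF : ∀ n ∈ F, 1 - κ * (1 / 2) ^ n ≤ I n)
    (hF : F ⊆ Finset.range M) : F.card - κ * 2 ≤ ∑ n ∈ Finset.range M, I n := by
  have hsum : (F.card : ℝ) ≤ ∑ n ∈ Finset.range M, (I n + κ * (1 / 2) ^ n) := calc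
    (F.card : ℝ) = ∑ _n ∈ F, (1 : ℝ) := by simp
    _ ≤ ∑ n ∈ F, (I n + κ * (1 / 2) ^ n) :=
      Finset.sum_le_sum fun n hn => sub_le_iff_le_add.1 (hIF n hn)
    _ ≤ _ := Finset.sum_le_sum_of_subset_of_nonneg hF fun n _ _ => neg_le_iff_add_nonneg.1 (hI n)
  rw [Finset.sum_add_distrib, ← Finset.mul_sum] at hsum
  linarith [mul_le_mul_of_nonneg_left (sum_geometric_two_le M) hκ]

theorem GridSequence.tendsto_glsIntegral_strategy (G : GridSequence α)
    (hg : HolderOnWith C α g (Icc 0 1)) (hβ : 0 < β) (hβ1 : β < 1) (hα : 1 - β < α)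
    (hexit : ∃ᶠ n in atTop, ∃ u ∈ Icc (G.τ n) (G.τ (n + 1)), 2 * G.ε n < |g u - g (G.τ n)|) :
    Tendsto (fun t => glsIntegral β (G.strategy g) g 0 t) (𝓝[<] 1) atTop := by
  have hα0 : 0 < α := by exact_mod_cast (sub_pos.2 hβ1).trans hα
  have hsmall : ∀ᶠ n : ℕ in atTop, C ^ 2 * (1 / 2 : ℝ) ^ n ≤ 1 := by
    have hlim := (tendsto_pow_atTop_nhds_zero_of_lt_one one_half_pos.le
      (one_half_lt_one (α := ℝ))).const_mul ((C : ℝ) ^ 2)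
    rw [mul_zero] at hlim
    exact hlim.eventually_le_const one_pos
  have hinf := Nat.frequently_atTop_iff_infinite.1 (hexit.and_eventually hsmall)
  refine tendsto_atTop.2 fun R => ?_
  obtain ⟨j, hj⟩ := exists_nat_ge (R + (C ^ 2 + C) * 2)
  obtain ⟨F, hF, rfl⟩ := hinf.exists_subset_card_eq j
  filter_upwards [Ico_mem_nhdsLT (G.τ_lt_one (F.sup id + 1))] with t ht
  have ht0 : 0 ≤ t := (G.τ_nonneg _).trans ht.1
  have hgt : HolderOnWith C α g (Icc 0 t) := hg.mono (Icc_subset_Icc_right ht.2.le)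
  have hFt : ∀ n ∈ F, G.τ (n + 1) ≤ t := fun n hn =>
    (G.strictMono_τ.monotone (Nat.succ_le_succ (F.le_sup (f := id) hn))).trans ht.1
  obtain ⟨M, hM⟩ := G.exists_lt_τ ht.2
  have hgain := G.stoppedSquare_sub_le_integral_deriv_block hα0 hgt ht0
  rw [G.glsIntegral_strategy hgt hβ hβ1 hα ⟨ht0, ht.2⟩ hM]
  refine (le_sub_iff_add_le.2 hj).trans (card_sub_le_sum_range (by positivity)
    (fun n => ?_) (fun n hn => ?_) fun n hn => ?_)
  · exact (neg_le_sub_iff_le_add.2 (le_add_of_nonneg_left (stoppedSquare_nonneg _ _ _))).trans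
      (hgain n)
  · obtain ⟨hlarge, hsmall_n⟩ := hF hn
    have hgain_n := hgain n
    rwa [G.stoppedSquare_eq_one_of_exists_lt hg hsmall_n (hFt n hn) hlarge] at hgain_n
  · exact Finset.mem_range.2
      (n.lt_succ_self.trans (G.strictMono_τ.lt_iff_lt.1 ((hFt n hn).trans_lt hM)))

end Divergence

section LargeOscillations

variable {Ω : Type*} [MeasurableSpace Ω]

/-- Along some sequence of times in `[0, 1)` increasing to `1`, almost every path of `X` exceeds a
positive deterministic oscillation threshold on infinitely many of the consecutive intervals. The
thresholds may decay arbitrarily fast. -/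
def HasLargeOscillations (P : Measure Ω) (X : ℝ → Ω → ℝ) : Prop :=
  ∃ τ ε : ℕ → ℝ, 0 ≤ τ 0 ∧ StrictMono τ ∧ Tendsto τ atTop (𝓝 1) ∧ (∀ n, 0 < ε n) ∧
    ∀ᵐ ω ∂P, ∃ᶠ n in atTop, ∃ u ∈ Icc (τ n) (τ (n + 1)), ε n < |X u ω - X (τ n) ω|

variable {P : Measure Ω} {X : ℝ → Ω → ℝ} {α : ℝ}

theorem HasHolderPaths.ae_holderOnWith {α : ℝ≥0} (hX : HasHolderPaths P X α) :
    ∀ᵐ ω ∂P, ∃ C : ℝ≥0, HolderOnWith C α (fun t => X t ω) (Icc 0 1) := by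
  filter_upwards [hX] with ω ⟨C, hC⟩
  refine ⟨C.toNNReal, holderOnWith_of_abs_sub_le fun t ht s hs => (hC s hs t ht).trans ?_⟩
  exact mul_le_mul_of_nonneg_right (Real.le_coe_toNNReal C) (Real.rpow_nonneg (abs_nonneg _) _)

theorem exp_neg_mul_mul_rpow_le {C Δ : ℝ} (hα : α ≠ 0) (hC : 0 < C) (hΔ : 0 < Δ) :
    Real.exp (-(C * Δ * (Δ ^ (2 * α)) ^ (-(1 / α)))) ≤ Δ / C := by
  have hexponent : C * Δ * (Δ ^ (2 * α)) ^ (-(1 / α)) = C / Δ := by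
    rw [← Real.rpow_mul hΔ.le, show 2 * α * -(1 / α) = -(2 : ℕ) by field_simp; norm_num,
      Real.rpow_neg hΔ.le, Real.rpow_natCast]
    field_simp
  rw [hexponent, Real.exp_neg, ← inv_div C Δ]
  gcongr
  linarith [Real.add_one_le_exp (C / Δ)]

theorem HasSmallBallEstimate.hasLargeOscillations (hX : HasSmallBallEstimate P X α) (hα : 0 < α) :
    HasLargeOscillations P X := by
  obtain ⟨C, hC, δ, hδ, hδ1, hball⟩ := hX
  set Δ : ℕ → ℝ := fun n => δ / 2 ^ n with hΔ_def
  have hΔ : ∀ n, 0 < Δ n := fun n => by positivity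
  have hΔδ : ∀ n, Δ n ≤ δ := fun n => div_le_self hδ.le (one_le_pow₀ one_le_two)
  have hhalf : ∀ n, Δ n = 2 * Δ (n + 1) := fun n => by
    simp only [hΔ_def, pow_succ]
    field_simp
  have hmem : ∀ n, 1 - Δ n ∈ Icc (1 - δ) 1 := fun n =>
    ⟨sub_le_sub_left (hΔδ n) 1, sub_le_self 1 (hΔ n).le⟩
  have hlim : Tendsto Δ atTop (𝓝 0) :=
    tendsto_const_nhds.div_atTop (tendsto_pow_atTop_atTop_of_one_lt one_lt_two)
  have hbound : ∀ n, P {ω | ∀ u ∈ Icc (1 - Δ n) (1 - Δ (n + 1)),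
      |X u ω - X (1 - Δ n) ω| ≤ Δ (n + 1) ^ (2 * α)} ≤ ENNReal.ofReal (Δ (n + 1) / C) := fun n => by
    have hstep : 1 - Δ (n + 1) - (1 - Δ n) = Δ (n + 1) := by linarith [hhalf n]
    have hsmall := hball _ (hmem n) _ (hmem (n + 1)) (by linarith [hhalf n, hΔ (n + 1)])
      (Δ (n + 1) ^ (2 * α)) (Real.rpow_pos_of_pos (hΔ _) _) (by
        rw [hstep]
        exact Real.rpow_le_rpow_of_exponent_ge (hΔ _) ((hΔδ _).trans hδ1) (by linarith))
    rw [hstep] at hsmall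
    exact hsmall.trans (ENNReal.ofReal_le_ofReal (exp_neg_mul_mul_rpow_le hα.ne' hC (hΔ _)))
  have hsum : Summable fun n => Δ (n + 1) / C := by
    simpa only [hΔ_def, pow_succ', ← div_div] using (summable_geometric_two' δ).div_const C
  refine ⟨fun n => 1 - Δ n, fun n => Δ (n + 1) ^ (2 * α), by simpa [hΔ_def] using hδ1,
    strictMono_nat_of_lt_succ fun n => by linarith [hhalf n, hΔ (n + 1)],
    by simpa using hlim.const_sub 1, fun n => Real.rpow_pos_of_pos (hΔ _) _, ?_⟩
  filter_upwards [ae_eventually_notMem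
    (ne_top_of_le_ne_top hsum.tsum_ofReal_ne_top (ENNReal.tsum_le_tsum hbound))] with ω hω
  refine (hω.mono fun n hn => ?_).frequently
  simpa [and_assoc] using hn

end LargeOscillations

end

theorem mainTheorem5_general {Ω : Type*} [mΩ : MeasurableSpace Ω] (P : Measure Ω)
    (𝓕 : Filtration (Set.Icc (0 : ℝ) 1) mΩ)
    (X : ℝ → Ω → ℝ) (hX : ∀ t : Set.Icc (0 : ℝ) 1, Measurable[𝓕 t] (X t))
    (α : ℝ) (hα : 1 / 2 < α)
    (hHolder : HasHolderPaths P X α) (hOsc : HasLargeOscillations P X) :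
    ∃ φ : ℝ → Ω → ℝ,
      (∀ t : Set.Icc (0 : ℝ) 1, (t : ℝ) < 1 → Measurable[𝓕 t] (φ t)) ∧
      (∀ ω, ContinuousOn (fun t => φ t ω) (Set.Ico 0 1)) ∧
      (∀ ω, φ 0 ω = 0) ∧
      ∀ᵐ ω ∂P, ∀ β : ℝ, 0 < β → 1 - α < β → β < 1 →
        (∀ t ∈ Set.Ico (0 : ℝ) 1,
          GLSIntegrable β (fun s => φ s ω) (fun s => X s ω) 0 t) ∧
        Tendsto (fun t => glsIntegral β (fun s => φ s ω) (fun s => X s ω) 0 t)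
          (𝓝[<] 1) atTop := by
  lift α to NNReal using by linarith
  obtain ⟨τ, ε, hτ0, hτ, hτ1, hε, hexit⟩ := hOsc
  obtain ⟨G, rfl, hGε⟩ := exists_gridSequence hα hτ0 hτ hτ1 fun n => half_pos (hε n)
  refine ⟨fun t ω => G.strategy (fun s => X s ω) t, fun t ht => ?_, fun ω t ht => ?_,
    fun ω => G.strategy_zero _, ?_⟩
  · exact @GridSequence.measurable_strategy _ G Ω (𝓕 t) X t ht fun s hs =>
      (hX ⟨s, hs.1, hs.2.trans ht.le⟩).mono (𝓕.mono hs.2) le_rfl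
  · exact (G.contDiffAt_strategy _ ht.2).continuousAt.continuousWithinAt
  · filter_upwards [hHolder.ae_holderOnWith, hexit] with ω ⟨C, hC⟩ hω β hβ hαβ hβ1
    have hα' : 1 - β < α := by linarith
    refine ⟨fun t ht => G.glsIntegrable_strategy (hC.mono (Set.Icc_subset_Icc_right ht.2.le))
      hβ hβ1 hα' ht, G.tendsto_glsIntegral_strategy hC hβ hβ1 hα' ?_⟩
    simpa only [hGε, mul_div_cancel₀ _ (two_ne_zero' ℝ)] using hω

theorem mainTheorem5 {Ω : Type*} [mΩ : MeasurableSpace Ω] (P : Measure Ω) [IsProbabilityMeasure P]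
    (𝓕 : Filtration (Set.Icc (0 : ℝ) 1) mΩ)
    (X : ℝ → Ω → ℝ) (hX : ∀ t : Set.Icc (0 : ℝ) 1, Measurable[𝓕 t] (X t))
    (α : ℝ) (hα : 1 / 2 < α)
    (hHolder : HasHolderPaths P X α) (hSmall : HasSmallBallEstimate P X α) :
    ∃ φ : ℝ → Ω → ℝ,
      (∀ t : Set.Icc (0 : ℝ) 1, (t : ℝ) < 1 → Measurable[𝓕 t] (φ t)) ∧
      (∀ ω, ContinuousOn (fun t => φ t ω) (Set.Ico 0 1)) ∧
      (∀ ω, φ 0 ω = 0) ∧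
      ∀ᵐ ω ∂P, ∀ β : ℝ, 0 < β → 1 - α < β → β < 1 →
        (∀ t ∈ Set.Ico (0 : ℝ) 1,
          GLSIntegrable β (fun s => φ s ω) (fun s => X s ω) 0 t) ∧
        Tendsto (fun t => glsIntegral β (fun s => φ s ω) (fun s => X s ω) 0 t)
          (𝓝[<] 1) atTop :=
  mainTheorem5_general P 𝓕 X hX α hα hHolder (hSmall.hasLargeOscillations (by linarith))
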